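/- **Notation.** Let $d\ge 1$. For $n\ge 0$ let $H_n(t)=(-1)^n e^{t^2}\left(\frac{d}{dt}\right)^n e^{-t^2}$ and $h_n(t)=(2^n n!\sqrt{\pi})^{-1/2}H_n(t)e^{-t^2/2}$. For $\beta\in\mathbb N_0^d$ let $\mathcal H_\beta(x)=h_{\beta_1}(x_1)\cdots h_{\beta_d}(x_d)$, and let $\mathcal H_n(x,y)=\sum_{|\beta|=n}\mathcal H_\beta(x)\mathcal H_\beta(y)$, where $x,y\in\mathbb R^d$ and $|\beta|=\beta_1+\dots+\beta_d$. Fix a complex-valued function $\widehat a\in C^\infty[0,\infty)$ with $\operatorname{supp}\widehat a\subset[1/4,4]$ and $|\widehat a|>c>0$ on $[1/3,3]$ for some constant $c$, and put $$\Phi_0=\mathcal H_0,\qquad \Phi_j=\sum_{\nu=0}^\infty \widehat a\Big(\frac{\nu}{4^{j-1}}\Big)\mathcal H_\nu,\quad j\ge 1.$$ For a tempered distribution $f\in\mathcal S'(\mathbb R^d)$ let $\Phi_j*f(x)$ be the value of the linear functional $f$ at the Schwartz function $\Phi_j(x,\cdot)$. For $\alpha\in\mathbb R$ and $0<p,q\le\infty$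 the Hermite-Besov space $B^{\alpha q}_p$ is the set of all $f\in\mathcal S'$ with $$\|f\|_{B^{\alpha q}_p}=\Big(\sum_{j=0}^\infty\big(2^{\alpha j}\|\Phi_j*f\|_{L^p(\mathbb R^d)}\big)^q\Big)^{1/q}<\infty,$$ and, for $p<\infty$, the Hermite-Triebel-Lizorkin space $F^{\alpha q}_p$ is the set of all $f\in\mathcal S'$ with $$\|f\|_{F^{\alpha q}_p}=\Big\|\Big(\sum_{j=0}^\infty\big(2^{\alpha j}|\Phi_j*f(\cdot)|\big)^q\Big)^{1/q}\Big\|_{L^p(\mathbb R^d)}<\infty,$$ with the $\ell^q$-norm replaced by the supremum when $q=\infty$. We write $X\hookrightarrow Y$ if $X\subset Y$ and there is a constant $C$ with $\|f\|_Y\le C\|f\|_X$ for all $f\in X$. **Proposition.** (a) If $0<p,q,q_1\le\infty$, $\alpha\in\mathbb R$ and $\varepsilon>0$, then $B^{\alpha+\varepsilon,q}_p\hookrightarrow B^{\alpha q_1}_p$. (b) If $0<p<p_1<\infty$, $0<q\le\infty$, $-\infty<\alpha_1<\alpha<\infty$ and $\alpha-d/p=\alpha_1-d/p_1$, then $B^{\alpha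 q}_p\hookrightarrow B^{\alpha_1 q}_{p_1}$. (c) If $0<p<\infty$, $0<q\le\infty$ and $\alpha\in\mathbb R$, then $B^{\alpha,\min\{p,q\}}_p\hookrightarrow F^{\alpha q}_p\hookrightarrow B^{\alpha,\max\{p,q\}}_p$. -/

import Mathlib

open MeasureTheory Set
open scoped SchwartzMap ENNReal NNReal ContDiff

noncomputable section

namespace HermiteSpaces

/-! ### Hermite polynomials and Hermite functions -/

/-- The (physicists') Hermite polynomial
`H_n(t) = (-1)^n e^{t^2} (d/dt)^n e^{-t^2}`, as a function on `ℝ`. -/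
def hermitePoly (n : ℕ) (t : ℝ) : ℝ :=
  (-1) ^ n * Real.exp (t ^ 2) * iteratedDeriv n (fun s : ℝ => Real.exp (-s ^ 2)) t

/-- The `L²(ℝ)`-normalized Hermite function
`h_n(t) = (2^n n! √π)^{-1/2} H_n(t) e^{-t^2/2}`. -/
def hermiteFun (n : ℕ) (t : ℝ) : ℝ :=
  (Real.sqrt (2 ^ n * (n.factorial : ℝ) * Real.sqrt Real.pi))⁻¹ *
    hermitePoly n t * Real.exp (-t ^ 2 / 2)

/-- The `d`-dimensional Hermite function
`𝓗_β(x) = h_{β₁}(x₁) ⋯ h_{β_d}(x_d)` on Euclidean space. -/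
def hermiteFunction {d : ℕ} (β : Fin d → ℕ) (x : EuclideanSpace ℝ (Fin d)) : ℝ :=
  ∏ i, hermiteFun (β i) (x i)

/-! ### Hermite functions are Schwartz functions -/

theorem iteratedDeriv_gauss (n : ℕ) : ∃ p : Polynomial ℝ,
    iteratedDeriv n (fun s : ℝ => Real.exp (-s ^ 2)) =
      fun t => p.eval t * Real.exp (-t ^ 2) := by
  induction n with
  | zero => exact ⟨1, by simp⟩
  | succ n ih =>
    obtain ⟨p, hp⟩ := ih
    refine ⟨Polynomial.derivative p - 2 * Polynomial.X * p, ?_⟩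
    rw [iteratedDeriv_succ, hp]
    funext t
    have h1 : HasDerivAt (fun s : ℝ => Real.exp (-s ^ 2)) (Real.exp (-t ^ 2) * (-(2 * t))) t := by
      have h2 : HasDerivAt (fun s : ℝ => -s ^ 2) (-(2 * t)) t := by
        have h3 := (hasDerivAt_pow 2 t).fun_neg
        simpa using h3
      exact h2.exp
    rw [((p.hasDerivAt t).fun_mul h1).deriv]
    simp only [Polynomial.eval_sub, Polynomial.eval_mul, Polynomial.eval_X,
      Polynomial.eval_ofNat]
    ring

theorem hermitePoly_eq (n : ℕ) : ∃ p : Polynomial ℝ, ∀ t, hermitePoly n t = p.eval t := by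
  obtain ⟨p, hp⟩ := iteratedDeriv_gauss n
  refine ⟨Polynomial.C ((-1) ^ n) * p, fun t => ?_⟩
  have h : Real.exp (t ^ 2) * Real.exp (-t ^ 2) = 1 := by
    rw [← Real.exp_add]; simp
  rw [hermitePoly, hp, Polynomial.eval_mul, Polynomial.eval_C]
  calc _ = (-1) ^ n * Polynomial.eval t p * (Real.exp (t ^ 2) * Real.exp (-t ^ 2)) := by ring
    _ = _ := by rw [h, mul_one]

theorem polyCoord_temperate {d : ℕ} (p : Polynomial ℝ) (i : Fin d) :
    (fun x : EuclideanSpace ℝ (Fin d) => p.eval (x i)).HasTemperateGrowth := by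
  have hc : (fun x : EuclideanSpace ℝ (Fin d) => x i).HasTemperateGrowth :=
    (EuclideanSpace.proj i : EuclideanSpace ℝ (Fin d) →L[ℝ] ℝ).hasTemperateGrowth
  induction p using Polynomial.induction_on' with
  | add p q hp hq =>
    simp only [Polynomial.eval_add]
    exact hp.add hq
  | monomial n c =>
    simp only [Polynomial.eval_monomial]
    exact (Function.HasTemperateGrowth.const c).mul (hc.pow n)

theorem prod_temperate {d : ℕ} {ι : Type*} (s : Finset ι)
    (g : ι → EuclideanSpace ℝ (Fin d) → ℝ) (hg : ∀ i ∈ s, (g i).HasTemperateGrowth) :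
    (fun x => ∏ i ∈ s, g i x).HasTemperateGrowth := by
  classical
  induction s using Finset.induction_on with
  | empty => simp
  | insert i s hi ih =>
    simp only [Finset.prod_insert hi]
    exact (hg i (by simp)).mul (ih fun j hj => hg j (by simp [hj]))

theorem normSq_temperate (d : ℕ) :
    (fun x : EuclideanSpace ℝ (Fin d) => -‖x‖ ^ 2 / 2).HasTemperateGrowth := by
  have h : (fun x : EuclideanSpace ℝ (Fin d) => -‖x‖ ^ 2 / 2) =
      fun x => ∑ i : Fin d, (-1 / 2 : ℝ) * (x i) ^ 2 := by
    funext x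
    rw [EuclideanSpace.norm_sq_eq, ← Finset.mul_sum]
    simp only [Real.norm_eq_abs, sq_abs]
    ring
  rw [h]
  refine Function.HasTemperateGrowth.sum fun i _ => ?_
  have := polyCoord_temperate (Polynomial.C (-1 / 2 : ℝ) * Polynomial.X ^ 2) i
  simpa only [Polynomial.eval_mul, Polynomial.eval_C, Polynomial.eval_pow,
    Polynomial.eval_X] using this

theorem gauss_decay (N : ℕ) (r : ℝ) (hr : 0 ≤ r) :
    (1 + r) ^ N * Real.exp (-r ^ 2 / 2) ≤ N.factorial * Real.exp (3 / 2) := by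
  have h1 : (1 + r) ^ N ≤ N.factorial * Real.exp (1 + r) := by
    have := Real.pow_div_factorial_le_exp (1 + r) (by linarith) N
    rwa [div_le_iff₀ (by positivity), mul_comm] at this
  calc (1 + r) ^ N * Real.exp (-r ^ 2 / 2)
      ≤ (N.factorial * Real.exp (1 + r)) * Real.exp (-r ^ 2 / 2) := by gcongr
    _ = N.factorial * Real.exp (1 + r + -r ^ 2 / 2) := by rw [mul_assoc, ← Real.exp_add]
    _ ≤ N.factorial * Real.exp (3 / 2) := by
        gcongr
        nlinarith [sq_nonneg (r - 1)]

/-- The Gaussian `e^{-|x|²/2}` as a real Schwartz function. -/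
def gaussianSchwartz (d : ℕ) : 𝓢(EuclideanSpace ℝ (Fin d), ℝ) where
  toFun x := Real.exp (-‖x‖ ^ 2 / 2)
  smooth' := (normSq_temperate d).1.exp
  decay' m n := by
    obtain ⟨k, C, hC, hb⟩ := (normSq_temperate d).norm_iteratedFDeriv_le_uniform n
    refine ⟨n.factorial * (C + 1) ^ n *
      ((m + k * n).factorial * Real.exp (3 / 2)), fun x => ?_⟩
    have hx : (0 : ℝ) ≤ ‖x‖ := norm_nonneg x
    have hD : (1 : ℝ) ≤ (C + 1) * (1 + ‖x‖) ^ k := by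
      have : (1 : ℝ) ≤ (1 + ‖x‖) ^ k := one_le_pow₀ (by linarith)
      nlinarith
    have key := norm_iteratedFDeriv_comp_le (𝕜 := ℝ) (g := Real.exp)
      (f := fun x : EuclideanSpace ℝ (Fin d) => -‖x‖ ^ 2 / 2) (n := n) (N := ∞)
      Real.contDiff_exp (normSq_temperate d).1 (by exact_mod_cast le_top) x
      (C := Real.exp (-‖x‖ ^ 2 / 2)) (D := (C + 1) * (1 + ‖x‖) ^ k)
      (fun i _ => by
        rw [norm_iteratedFDeriv_eq_norm_iteratedDeriv, iteratedDeriv_eq_iterate,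
          Real.iter_deriv_exp, Real.norm_eq_abs, abs_of_pos (Real.exp_pos _)])
      (fun i hi hin => by
        refine (hb i hin x).trans ?_
        refine le_trans ?_ (le_self_pow₀ hD (by omega))
        have : (0 : ℝ) ≤ (1 + ‖x‖) ^ k := by positivity
        nlinarith)
    have hm : ‖x‖ ^ m ≤ (1 + ‖x‖) ^ m := by gcongr; linarith
    calc ‖x‖ ^ m * ‖iteratedFDeriv ℝ n
            (fun x : EuclideanSpace ℝ (Fin d) => Real.exp (-‖x‖ ^ 2 / 2)) x‖
        ≤ (1 + ‖x‖) ^ m * (n.factorial * Real.exp (-‖x‖ ^ 2 / 2) *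
            ((C + 1) * (1 + ‖x‖) ^ k) ^ n) := by
          gcongr
          exact key
      _ = n.factorial * (C + 1) ^ n *
            ((1 + ‖x‖) ^ (m + k * n) * Real.exp (-‖x‖ ^ 2 / 2)) := by
          rw [mul_pow, ← pow_mul, pow_add]; ring
      _ ≤ _ := by
          refine mul_le_mul_of_nonneg_left (gauss_decay _ _ hx) ?_
          positivity

theorem exists_schwartz_hermite {d : ℕ} (β : Fin d → ℕ) :
    ∃ φ : 𝓢(EuclideanSpace ℝ (Fin d), ℂ), ∀ x, φ x = (hermiteFunction β x : ℂ) := by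
  choose p hp using fun i => hermitePoly_eq (β i)
  set c : ℝ := ∏ i : Fin d,
    (Real.sqrt (2 ^ (β i) * ((β i).factorial : ℝ) * Real.sqrt Real.pi))⁻¹ with hc
  have hg : (fun x : EuclideanSpace ℝ (Fin d) =>
      c * ∏ i, (p i).eval (x i)).HasTemperateGrowth :=
    (Function.HasTemperateGrowth.const c).mul
      (prod_temperate Finset.univ (fun i x => (p i).eval (x i))
        fun i _ => polyCoord_temperate (p i) i)
  refine ⟨SchwartzMap.postcompCLM Complex.ofRealCLM
    (SchwartzMap.smulLeftCLM ℝ (fun x => c * ∏ i, (p i).eval (x i)) (gaussianSchwartz d)),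
    fun x => ?_⟩
  have h1 : Real.exp (-‖x‖ ^ 2 / 2) = ∏ i, Real.exp (-(x i) ^ 2 / 2) := by
    rw [← Real.exp_sum, EuclideanSpace.norm_sq_eq]
    congr 1
    simp only [Real.norm_eq_abs, sq_abs]
    rw [← Finset.sum_neg_distrib, Finset.sum_div]
  have h2 : gaussianSchwartz d x = Real.exp (-‖x‖ ^ 2 / 2) := rfl
  rw [SchwartzMap.postcompCLM_apply, SchwartzMap.smulLeftCLM_apply_apply hg, h2, h1]
  simp only [smul_eq_mul, Complex.ofRealCLM_apply, hermiteFunction, hermiteFun, hp,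
    Finset.prod_mul_distrib, hc]

/-- The Hermite function `𝓗_β` as a (complex valued) Schwartz function. -/
def hermiteSchwartz {d : ℕ} (β : Fin d → ℕ) : 𝓢(EuclideanSpace ℝ (Fin d), ℂ) :=
  (exists_schwartz_hermite β).choose

theorem hermiteSchwartz_apply {d : ℕ} (β : Fin d → ℕ) (x : EuclideanSpace ℝ (Fin d)) :
    hermiteSchwartz β x = (hermiteFunction β x : ℂ) :=
  (exists_schwartz_hermite β).choose_spec x

/-! ### Kernels

A kernel `Φ(x, y)` which is Schwartz in `y` is a map `x ↦ Φ(x, ·)` into the Schwartz space. -/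

/-- The kernel `𝓗_n(x, y) = ∑_{|β| = n} 𝓗_β(x) 𝓗_β(y)` of the orthogonal projection of `L²(ℝ^d)`
onto the span of the `𝓗_β`, `|β| = n`; here `β` runs over the multi-indices with sum `n`. -/
def projKernel {d : ℕ} (n : ℕ) (x : EuclideanSpace ℝ (Fin d)) :
    𝓢(EuclideanSpace ℝ (Fin d), ℂ) :=
  ∑ β ∈ Finset.piAntidiag (Finset.univ : Finset (Fin d)) n,
    (hermiteFunction β x : ℂ) • hermiteSchwartz β

theorem projKernel_apply {d : ℕ} (n : ℕ) (x y : EuclideanSpace ℝ (Fin d)) :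
    projKernel n x y = ∑ β ∈ Finset.piAntidiag (Finset.univ : Finset (Fin d)) n,
      (hermiteFunction β x : ℂ) * (hermiteFunction β y : ℂ) := by
  simp [projKernel, hermiteSchwartz_apply]

/-- The conditions on the function `â` which generates the kernels:
`â ∈ C^∞[0, ∞)`, `supp â ⊆ [1/4, 4]`, and `|â| > c > 0` on `[1/3, 3]`.
Only the values of `a` on `[0, ∞)` matter. -/
structure IsAdmissible (a : ℝ → ℂ) : Prop where
  smooth : ContDiffOn ℝ ∞ a (Ici 0)
  support_subset : ∀ t, 0 ≤ t → a t ≠ 0 → t ∈ Icc (1 / 4 : ℝ) 4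
  bounded_below : ∃ c : ℝ, 0 < c ∧ ∀ t ∈ Icc (1 / 3 : ℝ) 3, c < ‖a t‖

/-- The kernels `Φ_0 = 𝓗_0` and `Φ_j = ∑_{ν ≥ 0} â(ν / 4^{j-1}) 𝓗_ν`, `j ≥ 1`
(for admissible `â` the sum has finitely many nonzero terms). -/
def dyadicKernel {d : ℕ} (a : ℝ → ℂ) (j : ℕ) (x : EuclideanSpace ℝ (Fin d)) :
    𝓢(EuclideanSpace ℝ (Fin d), ℂ) :=
  match j with
  | 0 => projKernel 0 x
  | i + 1 => ∑' ν : ℕ, a ((ν : ℝ) / 4 ^ i) • projKernel ν x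

/-- `Φ * f (x) = ⟨f, conj Φ(x, ·)⟩` for a tempered distribution `f`. Since the sesquilinear pairing
is `⟨f, φ⟩ = f (conj φ)`, this is `f` applied to `Φ(x, ·)`. -/
def kernelConv {d : ℕ} (Φ : EuclideanSpace ℝ (Fin d) → 𝓢(EuclideanSpace ℝ (Fin d), ℂ))
    (f : 𝓢'(EuclideanSpace ℝ (Fin d), ℂ)) (x : EuclideanSpace ℝ (Fin d)) : ℂ :=
  f (Φ x)

/-! ### Hermite-Besov and Hermite-Triebel-Lizorkin spaces -/

/-- The `ℓ^q` quasi-norm of a sequence in `[0, ∞]`: `(∑_j u_j^q)^{1/q}` for `0 < q < ∞`,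
and `sup_j u_j` for `q = ∞`. -/
def lqNorm (q : ℝ≥0∞) (u : ℕ → ℝ≥0∞) : ℝ≥0∞ :=
  if q = ⊤ then ⨆ j, u j else (∑' j, u j ^ q.toReal) ^ (1 / q.toReal)

/-- The extended quasi-norm
`‖f‖_{B^{αq}_p} = (∑_j (2^{αj} ‖Φ_j * f‖_p)^q)^{1/q}` of a tempered distribution. -/
def besovNorm {d : ℕ} (a : ℝ → ℂ) (α : ℝ) (p q : ℝ≥0∞)
    (f : 𝓢'(EuclideanSpace ℝ (Fin d), ℂ)) : ℝ≥0∞ :=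
  lqNorm q fun j => (2 : ℝ≥0∞) ^ (α * (j : ℝ)) *
    eLpNorm (kernelConv (dyadicKernel a j) f) p volume

/-- The extended quasi-norm
`‖f‖_{F^{αq}_p} = ‖(∑_j (2^{αj} |Φ_j * f(·)|)^q)^{1/q}‖_p` of a tempered distribution. -/
def triebelLizorkinNorm {d : ℕ} (a : ℝ → ℂ) (α : ℝ) (p q : ℝ≥0∞)
    (f : 𝓢'(EuclideanSpace ℝ (Fin d), ℂ)) : ℝ≥0∞ :=
  eLpNorm (fun x => lqNorm q fun j => (2 : ℝ≥0∞) ^ (α * (j : ℝ)) *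
    ‖kernelConv (dyadicKernel a j) f x‖ₑ) p volume

/-- The space of all tempered distributions with finite extended quasi-norm `N`. -/
def finiteSpace {d : ℕ} (N : 𝓢'(EuclideanSpace ℝ (Fin d), ℂ) → ℝ≥0∞) :
    Set 𝓢'(EuclideanSpace ℝ (Fin d), ℂ) :=
  {f | N f < ⊤}

/-- Continuous embedding `X ↪ Y` of the spaces `X`, `Y` of tempered distributions with finite
quasi-norm `N₁`, `N₂` respectively: `X ⊆ Y` and, for a constant `C`,
`‖f‖_Y ≤ C ‖f‖_X` for all `f ∈ X`. -/
def ContinuouslyEmbeds {d : ℕ} (N₁ N₂ : 𝓢'(EuclideanSpace ℝ (Fin d), ℂ) → ℝ≥0∞) : Prop :=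
  finiteSpace N₁ ⊆ finiteSpace N₂ ∧
    ∃ C : ℝ≥0, ∀ f ∈ finiteSpace N₁, N₂ f ≤ (C : ℝ≥0∞) * N₁ f

end HermiteSpaces

end

namespace HermiteSpaces

/-! ### Sequence quasi-norms -/

/-! Parts (a) and (c) are facts about sequences of nonnegative functions. For (a), every term of a
weighted sequence is at most its whole quasi-norm, and the spare factors `2^(-εj)` have finite
`ℓ^{q₁}` quasi-norm. For (c), Minkowski's inequality compares `ℓ^s(L^p)` with `L^p(ℓ^s)`, in one
direction for `s = min p q` and in the other for `s = max p q`; monotonicity of `ℓ^s` in `s` then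
replaces `s` by `q` pointwise.

Part (b) rests on `Φ_j * f` being a finite Hermite expansion of order at most `4^j` in each
variable, hence on a Nikolskii inequality `‖g‖_{p₁} ≤ C 2^{jd(1/p - 1/p₁)} ‖g‖_p` for such `g`. Its
source is the bound `∑_{n ≤ N} h_n² ≤ √(2(N+1))` (`sum_hermiteFun_sq_le`): the derivative of the
left side telescopes to a single product `h_N h_{N+1}`, whose integral orthonormality controls.
Cauchy–Schwarz and Parseval turn this into an `L^∞`–`L²` inequality.

Other exponents come from powers: `g(x/√m)^m` is a polynomial times `e^{-|x|²/2}`, so it is again a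
Hermite expansion, of order `m 4^j`. This gives `L^∞`–`L^{2m}`. For `2m > p`, bounding `|g|^{2m}` by
`‖g‖_∞^{2m-p} |g|^p` and cancelling the finite supremum gives `L^∞`–`L^p`, also for `p < 1`.
Interpolating between `L^p` and `L^∞` gives `L^p`–`L^{p₁}`. -/

theorem le_lqNorm {q : ℝ≥0∞} (hq : 0 < q) (u : ℕ → ℝ≥0∞) (j : ℕ) : u j ≤ lqNorm q u := by
  unfold lqNorm
  split_ifs with h
  · exact le_iSup u j
  · have hq' : 0 < q.toReal := ENNReal.toReal_pos hq.ne' h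
    rw [one_div, ENNReal.le_rpow_inv_iff hq']
    exact ENNReal.le_tsum (f := fun j => u j ^ q.toReal) j

theorem lqNorm_mono {q : ℝ≥0∞} {u v : ℕ → ℝ≥0∞} (h : ∀ j, u j ≤ v j) :
    lqNorm q u ≤ lqNorm q v := by
  unfold lqNorm
  split_ifs
  · exact iSup_mono h
  · refine ENNReal.rpow_le_rpow (ENNReal.tsum_le_tsum fun j => ?_) (by positivity)
    exact ENNReal.rpow_le_rpow (h j) ENNReal.toReal_nonneg

theorem lqNorm_const_mul {q : ℝ≥0∞} (hq : 0 < q) (c : ℝ≥0∞) (u : ℕ → ℝ≥0∞) :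
    lqNorm q (fun j => c * u j) = c * lqNorm q u := by
  unfold lqNorm
  split_ifs with h
  · rw [ENNReal.mul_iSup]
  · have hq' : 0 < q.toReal := ENNReal.toReal_pos hq.ne' h
    simp_rw [ENNReal.mul_rpow_of_nonneg _ _ hq'.le]
    rw [ENNReal.tsum_mul_left, ENNReal.mul_rpow_of_nonneg _ _ (by positivity), one_div,
      ENNReal.rpow_rpow_inv hq'.ne']

/-- The quasi-norms of `ℓ^q` decrease in `q`. -/
theorem lqNorm_anti {p q : ℝ≥0∞} (hp : 0 < p) (hpq : p ≤ q) (u : ℕ → ℝ≥0∞) :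
    lqNorm q u ≤ lqNorm p u := by
  by_cases hq : q = ⊤
  · rw [lqNorm, if_pos hq]
    exact iSup_le fun j => le_lqNorm hp u j
  have hp' : p ≠ ⊤ := ne_top_of_le_ne_top hq hpq
  have hp0 : 0 < p.toReal := ENNReal.toReal_pos hp.ne' hp'
  have hq0 : 0 < q.toReal := ENNReal.toReal_pos (hp.trans_le hpq).ne' hq
  have hle : p.toReal ≤ q.toReal := ENNReal.toReal_mono hq hpq
  set A := lqNorm p u with hA
  have hAp : A ^ p.toReal = ∑' j, u j ^ p.toReal := by
    rw [hA, lqNorm, if_neg hp', one_div, ENNReal.rpow_inv_rpow hp0.ne']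
  rw [lqNorm, if_neg hq, one_div, ENNReal.rpow_inv_le_iff hq0]
  -- Each `u j` is at most `A`, so `q - p` of its `q` powers can be traded for powers of `A`.
  calc ∑' j, u j ^ q.toReal
      = ∑' j, u j ^ (q.toReal - p.toReal) * u j ^ p.toReal := by
        congr with j
        rw [← ENNReal.rpow_add_of_nonneg _ _ (by linarith) hp0.le, sub_add_cancel]
    _ ≤ ∑' j, A ^ (q.toReal - p.toReal) * u j ^ p.toReal := by
        refine ENNReal.tsum_le_tsum fun j => ?_
        exact mul_le_mul_left (ENNReal.rpow_le_rpow (le_lqNorm hp u j) (by linarith)) _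
    _ = A ^ q.toReal := by
        rw [ENNReal.tsum_mul_left, ← hAp, ← ENNReal.rpow_add_of_nonneg _ _ (by linarith) hp0.le,
          sub_add_cancel]

theorem two_rpow_add (x y : ℝ) : (2 : ℝ≥0∞) ^ (x + y) = 2 ^ x * 2 ^ y :=
  ENNReal.rpow_add _ _ (by norm_num) (by norm_num)

theorem two_rpow_lt_one {x : ℝ} (hx : x < 0) : (2 : ℝ≥0∞) ^ x < 1 :=
  ENNReal.rpow_lt_one_of_one_lt_of_neg (by norm_num) hx

theorem lqNorm_geometric_lt_top {q : ℝ≥0∞} (hq : 0 < q) {ε : ℝ} (hε : 0 < ε) :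
    lqNorm q (fun j => (2 : ℝ≥0∞) ^ (-ε * (j : ℝ))) < ⊤ := by
  unfold lqNorm
  split_ifs with h
  · refine lt_of_le_of_lt (iSup_le fun j => ?_) ENNReal.one_lt_top
    rcases j.eq_zero_or_pos with rfl | hj
    · simp
    · exact (two_rpow_lt_one (by nlinarith [Nat.cast_pos (α := ℝ).2 hj])).le
  · have hq' : 0 < q.toReal := ENNReal.toReal_pos hq.ne' h
    refine ENNReal.rpow_lt_top_of_nonneg (by positivity) ?_
    have : ∀ j : ℕ, ((2 : ℝ≥0∞) ^ (-ε * (j : ℝ))) ^ q.toReal = (2 ^ (-ε * q.toReal)) ^ j := by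
      intro j
      rw [← ENNReal.rpow_mul, ← ENNReal.rpow_natCast, ← ENNReal.rpow_mul]
      congr 1
      ring
    simp_rw [this]
    rw [ENNReal.tsum_geometric]
    refine ENNReal.inv_ne_top.2 (tsub_pos_of_lt (two_rpow_lt_one ?_)).ne'
    nlinarith [mul_pos hε hq']

/-- Extra smoothness pays for any change of the summation index. -/
theorem lqNorm_weight_le {q q₁ : ℝ≥0∞} (hq : 0 < q) (hq₁ : 0 < q₁) (α ε : ℝ) (u : ℕ → ℝ≥0∞) :
    lqNorm q₁ (fun j => 2 ^ (α * (j : ℝ)) * u j) ≤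
      lqNorm q₁ (fun j => (2 : ℝ≥0∞) ^ (-ε * (j : ℝ))) *
        lqNorm q (fun j => 2 ^ ((α + ε) * (j : ℝ)) * u j) := by
  rw [mul_comm, ← lqNorm_const_mul hq₁]
  refine lqNorm_mono fun j => ?_
  -- The exponent `q` enters only through this bound of one term by the whole quasi-norm.
  have h := le_lqNorm hq (fun j : ℕ => (2 : ℝ≥0∞) ^ ((α + ε) * (j : ℝ)) * u j) j
  calc (2 : ℝ≥0∞) ^ (α * (j : ℝ)) * u j
      = (2 ^ ((α + ε) * (j : ℝ)) * u j) * 2 ^ (-ε * (j : ℝ)) := by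
        rw [mul_right_comm, ← two_rpow_add]
        congr 2
        ring
    _ ≤ _ := by gcongr

/-! ### Minkowski inequalities -/

section Minkowski

variable {X : Type*} [MeasurableSpace X] {μ : Measure X}

theorem lintegral_Lp_sum_le {r : ℝ} (hr : 1 ≤ r) {u : ℕ → X → ℝ≥0∞}
    (hu : ∀ j, Measurable (u j)) (n : ℕ) :
    (∫⁻ x, (∑ j ∈ Finset.range n, u j x) ^ r ∂μ) ^ (1 / r) ≤
      ∑ j ∈ Finset.range n, (∫⁻ x, u j x ^ r ∂μ) ^ (1 / r) := by
  have hr0 : 0 < r := by linarith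
  induction n with
  | zero => simp [hr0]
  | succ n ih =>
    simp_rw [Finset.sum_range_succ]
    refine le_trans ?_ (add_le_add_left ih _)
    exact ENNReal.lintegral_Lp_add_le (f := fun x => ∑ j ∈ Finset.range n, u j x)
      (Finset.measurable_fun_sum _ fun j _ => hu j).aemeasurable (hu n).aemeasurable hr

theorem lintegral_Lp_tsum_le {r : ℝ} (hr : 1 ≤ r) {u : ℕ → X → ℝ≥0∞}
    (hu : ∀ j, Measurable (u j)) :
    (∫⁻ x, (∑' j, u j x) ^ r ∂μ) ^ (1 / r) ≤ ∑' j, (∫⁻ x, u j x ^ r ∂μ) ^ (1 / r) := by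
  have hr0 : 0 < r := by linarith
  have h1 : Filter.Tendsto (fun n => ∫⁻ x, (∑ j ∈ Finset.range n, u j x) ^ r ∂μ) Filter.atTop
      (nhds (∫⁻ x, (∑' j, u j x) ^ r ∂μ)) := by
    refine lintegral_tendsto_of_tendsto_of_monotone
      (fun n => ((Finset.measurable_fun_sum _ fun j _ => hu j).pow_const r).aemeasurable) ?_ ?_
    · refine Filter.Eventually.of_forall fun x m n hmn => ?_
      refine ENNReal.rpow_le_rpow (Finset.sum_le_sum_of_subset ?_) hr0.le
      exact Finset.range_mono hmn
    · refine Filter.Eventually.of_forall fun x => ?_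
      exact (ENNReal.continuous_rpow_const.tendsto _).comp (ENNReal.tendsto_nat_tsum _)
  refine le_of_tendsto' ((ENNReal.continuous_rpow_const.tendsto _).comp h1) fun n => ?_
  exact (lintegral_Lp_sum_le hr hu n).trans (ENNReal.sum_le_tsum _)

/-- Duality proof: one factor of each `(∫ v_j)^r` is written as an integral, sum and integral are
exchanged, and Hölder in `j` produces `T^{1/r'}`, which is cancelled. The cancellation requires `T`
to be neither zero nor infinite. -/
theorem sum_lintegral_rpow_le {r : ℝ} (hr : 1 < r) {v : ℕ → X → ℝ≥0∞}
    (hv : ∀ j, Measurable (v j)) (s : Finset ℕ) :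
    (∑ j ∈ s, (∫⁻ x, v j x ∂μ) ^ r) ^ (1 / r) ≤ ∫⁻ x, (∑ j ∈ s, v j x ^ r) ^ (1 / r) ∂μ := by
  have hr0 : 0 < r := by linarith
  by_cases htop : ∃ j ∈ s, ∫⁻ x, v j x ∂μ = ⊤
  · obtain ⟨j, hj, hjt⟩ := htop
    refine le_top.trans (hjt.symm.le.trans (lintegral_mono fun x => ?_))
    simp only [one_div]
    rw [ENNReal.le_rpow_inv_iff hr0]
    exact Finset.single_le_sum (f := fun j => v j x ^ r) (fun _ _ => zero_le) hj
  push Not at htop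
  set T := ∑ j ∈ s, (∫⁻ x, v j x ∂μ) ^ r with hT
  have hTtop : T ≠ ⊤ := by
    rw [hT]
    exact ENNReal.sum_ne_top.2 fun j hj => ENNReal.rpow_ne_top_of_nonneg hr0.le (htop j hj)
  by_cases hT0 : T = 0
  · rw [hT0, ENNReal.zero_rpow_of_pos (by positivity)]
    exact zero_le
  have hc : (Real.conjExponent r).HolderConjugate r := (Real.HolderConjugate.conjExponent hr).symm
  set r' := Real.conjExponent r
  have hexp : (r - 1) * r' = r := by
    have := hc.symm.sub_one_mul_conj
    exact this
  have key : T ≤ T ^ (1 / r') * ∫⁻ x, (∑ j ∈ s, v j x ^ r) ^ (1 / r) ∂μ := by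
    calc T = ∑ j ∈ s, ∫⁻ x, (∫⁻ x, v j x ∂μ) ^ (r - 1) * v j x ∂μ := by
          rw [hT]
          refine Finset.sum_congr rfl fun j hj => ?_
          rw [lintegral_const_mul _ (hv j)]
          nth_rewrite 3 [← ENNReal.rpow_one (∫⁻ x, v j x ∂μ)]
          rw [← ENNReal.rpow_add_of_nonneg _ _ (by linarith) zero_le_one, sub_add_cancel]
      _ = ∫⁻ x, ∑ j ∈ s, (∫⁻ x, v j x ∂μ) ^ (r - 1) * v j x ∂μ := by
          rw [lintegral_finsetSum]
          exact fun j _ => (hv j).const_mul _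
      _ ≤ ∫⁻ x, T ^ (1 / r') * (∑ j ∈ s, v j x ^ r) ^ (1 / r) ∂μ := by
          refine lintegral_mono fun x => ?_
          refine (ENNReal.inner_le_Lp_mul_Lq s _ _ hc).trans (le_of_eq ?_)
          congr 2
          rw [hT]
          refine Finset.sum_congr rfl fun j _ => ?_
          rw [← ENNReal.rpow_mul, hexp]
      _ = _ := by
          rw [lintegral_const_mul]
          exact (Finset.measurable_fun_sum _ fun j _ => (hv j).pow_const r).pow_const _
  have hsplit : T = T ^ (1 / r') * T ^ (1 / r) := by
    rw [← ENNReal.rpow_add _ _ hT0 hTtop, one_div, one_div, hc.inv_add_inv_eq_one,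
      ENNReal.rpow_one]
  have hr'0 : 0 < r' := hc.pos
  -- The first rewrite splits every `T`; the second restores the base of the power on the right,
  -- leaving `T^{1/r'}` as a common factor.
  rw [hsplit] at key
  nth_rewrite 2 [← hsplit] at key
  exact (ENNReal.mul_le_mul_iff_right
    (ENNReal.rpow_pos (pos_iff_ne_zero.2 hT0) hTtop).ne'
    (ENNReal.rpow_ne_top_of_nonneg (by positivity) hTtop)).1 key

theorem tsum_lintegral_rpow_le {r : ℝ} (hr : 1 < r) {v : ℕ → X → ℝ≥0∞}
    (hv : ∀ j, Measurable (v j)) :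
    (∑' j, (∫⁻ x, v j x ∂μ) ^ r) ^ (1 / r) ≤ ∫⁻ x, (∑' j, v j x ^ r) ^ (1 / r) ∂μ := by
  have hr0 : 0 < r := by linarith
  rw [one_div, ENNReal.rpow_inv_le_iff hr0, ENNReal.tsum_eq_iSup_sum]
  refine iSup_le fun s => ?_
  rw [← ENNReal.rpow_inv_le_iff hr0]
  refine ((one_div r).symm ▸ sum_lintegral_rpow_le hr hv s).trans (lintegral_mono fun x => ?_)
  exact ENNReal.rpow_le_rpow (ENNReal.sum_le_tsum _) (by positivity)

/-- `ℓ^q(L^p)` embeds into `L^p(ℓ^q)` for `q ≤ p`. -/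
theorem eLpNorm_lqNorm_le_of_le {p q : ℝ≥0∞} (hp : p ≠ ⊤) (hq : 0 < q) (hqp : q ≤ p)
    {g : ℕ → X → ℝ≥0∞} (hg : ∀ j, Measurable (g j)) :
    eLpNorm (fun x => lqNorm q fun j => g j x) p μ ≤ lqNorm q fun j => eLpNorm (g j) p μ := by
  have hqt : q ≠ ⊤ := ne_top_of_le_ne_top hp hqp
  have hp0 : p ≠ 0 := (hq.trans_le hqp).ne'
  have hp' : 0 < p.toReal := ENNReal.toReal_pos hp0 hp
  have hq' : 0 < q.toReal := ENNReal.toReal_pos hq.ne' hqt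
  have hle : q.toReal ≤ p.toReal := ENNReal.toReal_mono hp hqp
  simp only [lqNorm, if_neg hqt, eLpNorm_eq_lintegral_rpow_enorm_toReal hp0 hp, enorm_eq_self]
  -- The triangle inequality of `L^{p/q}`, applied to `g_j^q`.
  have h := lintegral_Lp_tsum_le (μ := μ) (r := p.toReal / q.toReal)
    ((one_le_div hq').2 hle) (fun j => (hg j).pow_const q.toReal)
  rw [one_div_div] at h
  have h2 := ENNReal.rpow_le_rpow h (z := 1 / q.toReal) (by positivity)
  convert h2 using 1
  · rw [← ENNReal.rpow_mul]
    simp_rw [← ENNReal.rpow_mul]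
    congr 2
    · ext x
      congr 1
      field_simp
    · field_simp
  · simp_rw [← ENNReal.rpow_mul, mul_div_cancel₀ _ hq'.ne', one_div_mul_eq_div]

/-- `L^p(ℓ^q)` embeds into `ℓ^q(L^p)` for `p ≤ q`. -/
theorem lqNorm_eLpNorm_le_of_le {p q : ℝ≥0∞} (hp : p ≠ ⊤) (hp0 : 0 < p) (hpq : p ≤ q)
    {g : ℕ → X → ℝ≥0∞} (hg : ∀ j, Measurable (g j)) :
    lqNorm q (fun j => eLpNorm (g j) p μ) ≤ eLpNorm (fun x => lqNorm q fun j => g j x) p μ := by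
  have hp' : 0 < p.toReal := ENNReal.toReal_pos hp0.ne' hp
  by_cases hqt : q = ⊤
  · rw [lqNorm, if_pos hqt]
    refine iSup_le fun j => eLpNorm_mono_enorm fun x => ?_
    simp only [enorm_eq_self]
    exact le_lqNorm (hp0.trans_le hpq) (fun j => g j x) j
  have hq' : 0 < q.toReal := ENNReal.toReal_pos (hp0.trans_le hpq).ne' hqt
  simp only [lqNorm, if_neg hqt, eLpNorm_eq_lintegral_rpow_enorm_toReal hp0.ne' hp, enorm_eq_self]
  -- Equal exponents are Tonelli's theorem; the duality argument needs `q / p > 1`.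
  rcases hpq.eq_or_lt with rfl | hlt
  · simp_rw [← ENNReal.rpow_mul, one_div, inv_mul_cancel₀ hp'.ne', ENNReal.rpow_one]
    rw [lintegral_tsum fun j => ((hg j).pow_const _).aemeasurable]
  have hlt' : p.toReal < q.toReal := (ENNReal.toReal_lt_toReal hp hqt).2 hlt
  have h := tsum_lintegral_rpow_le (μ := μ) (r := q.toReal / p.toReal)
    ((one_lt_div hp').2 hlt') (fun j => (hg j).pow_const p.toReal)
  rw [one_div_div] at h
  have h2 := ENNReal.rpow_le_rpow h (z := 1 / p.toReal) (by positivity)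
  convert h2 using 1
  · rw [← ENNReal.rpow_mul]
    simp_rw [← ENNReal.rpow_mul, one_div_mul_eq_div]
    congr 1
    field_simp
  · simp_rw [← ENNReal.rpow_mul, mul_div_cancel₀ _ hp'.ne', one_div_mul_eq_div]

end Minkowski

theorem continuouslyEmbeds_of_le {d : ℕ} {N₁ N₂ : 𝓢'(EuclideanSpace ℝ (Fin d), ℂ) → ℝ≥0∞}
    {C : ℝ≥0∞} (hC : C < ⊤) (h : ∀ f, N₂ f ≤ C * N₁ f) : ContinuouslyEmbeds N₁ N₂ := by
  refine ⟨fun f hf => (h f).trans_lt (ENNReal.mul_lt_top hC hf), C.toNNReal, fun f _ => ?_⟩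
  rw [ENNReal.coe_toNNReal hC.ne]
  exact h f

end HermiteSpaces
namespace HermiteSpaces

/-! ### One-dimensional Hermite functions -/

theorem gauss_hasDerivAt_iteratedDeriv (n : ℕ) (t : ℝ) :
    HasDerivAt (iteratedDeriv n (fun s : ℝ => Real.exp (-s ^ 2)))
      (iteratedDeriv (n + 1) (fun s : ℝ => Real.exp (-s ^ 2)) t) t := by
  have h : ContDiff ℝ ∞ (fun s : ℝ => Real.exp (-s ^ 2)) := by fun_prop
  have hd : Differentiable ℝ (iteratedDeriv n (fun s : ℝ => Real.exp (-s ^ 2))) :=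
    h.differentiable_iteratedDeriv n (by exact_mod_cast WithTop.coe_lt_top _)
  rw [iteratedDeriv_succ]
  exact (hd t).hasDerivAt

theorem gauss_iteratedDeriv_one (t : ℝ) :
    iteratedDeriv 1 (fun s : ℝ => Real.exp (-s ^ 2)) t =
      -2 * t * iteratedDeriv 0 (fun s : ℝ => Real.exp (-s ^ 2)) t := by
  rw [iteratedDeriv_one, iteratedDeriv_zero]
  have h2 : HasDerivAt (fun s : ℝ => -s ^ 2) (-(2 * t)) t := by
    simpa using (hasDerivAt_pow 2 t).fun_neg
  rw [h2.exp.deriv]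
  ring

/-- Repeated differentiation of `g' = -2t g`: since `-2t` is linear, each differentiation adds just
one copy of `-2 g^{(n)}`. -/
theorem gauss_iteratedDeriv_recurrence (n : ℕ) (t : ℝ) :
    iteratedDeriv (n + 2) (fun s : ℝ => Real.exp (-s ^ 2)) t =
      -2 * t * iteratedDeriv (n + 1) (fun s : ℝ => Real.exp (-s ^ 2)) t -
        2 * (n + 1) * iteratedDeriv n (fun s : ℝ => Real.exp (-s ^ 2)) t := by
  induction n generalizing t with
  | zero =>
    have h := gauss_hasDerivAt_iteratedDeriv 1 t
    have h1 := ((hasDerivAt_id t).const_mul (-2)).mul (gauss_hasDerivAt_iteratedDeriv 0 t)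
    have h2 : iteratedDeriv 1 (fun s : ℝ => Real.exp (-s ^ 2)) =
        (fun y => -2 * id y) * iteratedDeriv 0 (fun s : ℝ => Real.exp (-s ^ 2)) := by
      ext y
      exact gauss_iteratedDeriv_one y
    rw [← h2] at h1
    rw [h.unique h1]
    simp
    ring
  | succ n ih =>
    have h := gauss_hasDerivAt_iteratedDeriv (n + 2) t
    have h1 := (((hasDerivAt_id t).const_mul (-2)).mul
      (gauss_hasDerivAt_iteratedDeriv (n + 1) t)).sub
        ((gauss_hasDerivAt_iteratedDeriv n t).const_mul (2 * ((n : ℝ) + 1)))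
    have h2 : iteratedDeriv (n + 2) (fun s : ℝ => Real.exp (-s ^ 2)) =
        (fun y => -2 * id y) * iteratedDeriv (n + 1) (fun s : ℝ => Real.exp (-s ^ 2)) -
          fun y => 2 * ((n : ℝ) + 1) * iteratedDeriv n (fun s : ℝ => Real.exp (-s ^ 2)) y := by
      ext y
      exact ih y
    rw [← h2] at h1
    rw [h.unique h1]
    simp
    ring

theorem hermitePoly_hasDerivAt (n : ℕ) (t : ℝ) :
    HasDerivAt (hermitePoly n) (2 * t * hermitePoly n t - hermitePoly (n + 1) t) t := by
  have h2 : HasDerivAt (fun s : ℝ => s ^ 2) (2 * t) t := by simpa using hasDerivAt_pow 2 t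
  have h := (h2.exp.const_mul ((-1) ^ n)).mul (gauss_hasDerivAt_iteratedDeriv n t)
  refine HasDerivAt.congr_deriv h ?_
  simp only [hermitePoly, pow_succ]
  ring

theorem hermitePoly_one (t : ℝ) : hermitePoly 1 t = 2 * t * hermitePoly 0 t := by
  simp only [hermitePoly, gauss_iteratedDeriv_one]
  ring

theorem hermitePoly_recurrence (n : ℕ) (t : ℝ) :
    hermitePoly (n + 2) t = 2 * t * hermitePoly (n + 1) t - 2 * (n + 1) * hermitePoly n t := by
  simp only [hermitePoly, gauss_iteratedDeriv_recurrence]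
  ring

/-- This ratio of normalizing constants is the source of the factors `√(2(n+1))` in the ladder
relations. -/
theorem hermite_norm_const_succ (n : ℕ) :
    (Real.sqrt (2 ^ n * (n.factorial : ℝ) * Real.sqrt Real.pi))⁻¹ = √(2 * (n + 1)) *
      (Real.sqrt (2 ^ (n + 1) * ((n + 1).factorial : ℝ) * Real.sqrt Real.pi))⁻¹ := by
  have h : (2 ^ (n + 1) * ((n + 1).factorial : ℝ) * Real.sqrt Real.pi) =
      (2 * (n + 1)) * (2 ^ n * (n.factorial : ℝ) * Real.sqrt Real.pi) := by
    rw [Nat.factorial_succ]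
    push_cast
    ring
  rw [h, Real.sqrt_mul (by positivity) (2 ^ n * _ * _), mul_inv, ← mul_assoc, mul_inv_cancel₀ (by positivity),
    one_mul]

theorem hermiteFun_hasDerivAt (n : ℕ) (t : ℝ) :
    HasDerivAt (hermiteFun n)
      (t * hermiteFun n t - √(2 * (n + 1)) * hermiteFun (n + 1) t) t := by
  have h2 : HasDerivAt (fun s : ℝ => -s ^ 2 / 2) (-t) t := by
    have := ((hasDerivAt_pow 2 t).fun_neg).div_const 2
    refine HasDerivAt.congr_deriv this ?_
    push_cast
    ring
  have h := ((hermitePoly_hasDerivAt n t).const_mul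
    (Real.sqrt (2 ^ n * (n.factorial : ℝ) * Real.sqrt Real.pi))⁻¹).mul h2.exp
  refine HasDerivAt.congr_deriv h ?_
  simp only [hermiteFun]
  rw [hermite_norm_const_succ n]
  ring

theorem hermiteFun_one (t : ℝ) : √2 * hermiteFun 1 t = 2 * t * hermiteFun 0 t := by
  have h := hermite_norm_const_succ 0
  simp only [hermiteFun]
  rw [h, hermitePoly_one]
  simp
  ring

theorem hermiteFun_recurrence (n : ℕ) (t : ℝ) :
    √(2 * (n + 1 + 1)) * hermiteFun (n + 2) t =
      2 * t * hermiteFun (n + 1) t - √(2 * (n + 1)) * hermiteFun n t := by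
  have h := hermite_norm_const_succ (n + 1)
  have h' := hermite_norm_const_succ n
  have hs : √(2 * ((n : ℝ) + 1)) ^ 2 = 2 * (n + 1) := Real.sq_sqrt (by positivity)
  push_cast at h
  simp only [hermiteFun]
  rw [h', hermitePoly_recurrence, h]
  set A := (√(2 ^ (n + 1 + 1) * ((n + 1 + 1).factorial : ℝ) * √Real.pi))⁻¹
  set B := √(2 * ((n : ℝ) + 1))
  set D := √(2 * ((n : ℝ) + 1 + 1))
  -- The coefficient `2(n+1)` of the polynomial recurrence is `B²`.
  linear_combination D * A * hermitePoly n t * Real.exp (-t ^ 2 / 2) * hs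

/-- Inserting the three-term recurrence into the raising formula gives the lowering operator `t +
d/dt`, which annihilates `h_0`. -/
theorem hermiteFun_zero_hasDerivAt (t : ℝ) :
    HasDerivAt (hermiteFun 0) (-t * hermiteFun 0 t) t := by
  convert hermiteFun_hasDerivAt 0 t using 1
  have := hermiteFun_one t
  simp only [CharP.cast_eq_zero, zero_add, mul_one, this]
  ring

theorem hermiteFun_succ_hasDerivAt (n : ℕ) (t : ℝ) :
    HasDerivAt (hermiteFun (n + 1))
      (-t * hermiteFun (n + 1) t + √(2 * (n + 1)) * hermiteFun n t) t := by
  convert hermiteFun_hasDerivAt (n + 1) t using 1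
  have := hermiteFun_recurrence n t
  push_cast
  rw [this]
  ring

/-! ### Integrals of products of Hermite functions -/

theorem integrable_polynomial_mul_gauss (p : Polynomial ℝ) :
    Integrable fun t : ℝ => p.eval t * Real.exp (-t ^ 2) := by
  induction p using Polynomial.induction_on' with
  | add p q hp hq =>
    simp only [Polynomial.eval_add, add_mul]
    exact hp.add hq
  | monomial n c =>
    have h := integrable_rpow_mul_exp_neg_mul_sq (b := 1) one_pos (s := n)
      (by linarith [n.cast_nonneg (α := ℝ)])
    simp only [Polynomial.eval_monomial, mul_assoc]
    refine Integrable.const_mul ?_ c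
    convert h using 3 with t
    · rw [Real.rpow_natCast]
    · ring_nf

/-- Products of a real polynomial and the Gaussian `e^{-t²/2}`. -/
def IsPolyGauss (f : ℝ → ℝ) : Prop :=
  ∃ p : Polynomial ℝ, ∀ t, f t = p.eval t * Real.exp (-t ^ 2 / 2)

theorem IsPolyGauss.integrable_mul {f g : ℝ → ℝ} (hf : IsPolyGauss f) (hg : IsPolyGauss g) :
    Integrable fun t => f t * g t := by
  obtain ⟨p, hp⟩ := hf
  obtain ⟨q, hq⟩ := hg
  convert integrable_polynomial_mul_gauss (p * q) using 2 with t
  rw [hp, hq, Polynomial.eval_mul, mul_mul_mul_comm, ← Real.exp_add]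
  ring_nf

theorem IsPolyGauss.add {f g : ℝ → ℝ} (hf : IsPolyGauss f) (hg : IsPolyGauss g) :
    IsPolyGauss fun t => f t + g t := by
  obtain ⟨p, hp⟩ := hf
  obtain ⟨q, hq⟩ := hg
  exact ⟨p + q, fun t => by simp only [hp, hq, Polynomial.eval_add, add_mul]⟩

theorem IsPolyGauss.polynomial_mul {f : ℝ → ℝ} (hf : IsPolyGauss f) (q : Polynomial ℝ) :
    IsPolyGauss fun t => q.eval t * f t := by
  obtain ⟨p, hp⟩ := hf
  exact ⟨q * p, fun t => by simp only [hp, Polynomial.eval_mul, mul_assoc]⟩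

theorem isPolyGauss_hermiteFun (n : ℕ) : IsPolyGauss (hermiteFun n) := by
  obtain ⟨p, hp⟩ := hermitePoly_eq n
  refine ⟨Polynomial.C (Real.sqrt (2 ^ n * (n.factorial : ℝ) * Real.sqrt Real.pi))⁻¹ * p,
    fun t => ?_⟩
  rw [hermiteFun, hp, Polynomial.eval_mul, Polynomial.eval_C]

theorem isPolyGauss_id_mul_hermiteFun (n : ℕ) : IsPolyGauss fun t => t * hermiteFun n t := by
  simpa using (isPolyGauss_hermiteFun n).polynomial_mul Polynomial.X

theorem isPolyGauss_const_mul_hermiteFun (c : ℝ) (n : ℕ) :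
    IsPolyGauss fun t => c * hermiteFun n t := by
  simpa using (isPolyGauss_hermiteFun n).polynomial_mul (Polynomial.C c)

theorem integrable_hermiteFun_mul (m n : ℕ) :
    Integrable fun t => hermiteFun m t * hermiteFun n t :=
  (isPolyGauss_hermiteFun m).integrable_mul (isPolyGauss_hermiteFun n)

/-- The raising operator `t - d/dt` is the adjoint of the lowering operator `t + d/dt`. -/
theorem integral_mul_hermiteFun_succ {u u' : ℝ → ℝ} (hu : IsPolyGauss u) (hu' : IsPolyGauss u')
    (hd : ∀ t, HasDerivAt u (u' t) t) (n : ℕ) :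
    √(2 * (n + 1)) * ∫ t, u t * hermiteFun (n + 1) t =
      ∫ t, (t * u t + u' t) * hermiteFun n t := by
  have hv : IsPolyGauss fun t => t * hermiteFun n t - √(2 * (n + 1)) * hermiteFun (n + 1) t := by
    simpa [sub_eq_add_neg] using (isPolyGauss_id_mul_hermiteFun n).add
      (isPolyGauss_const_mul_hermiteFun (-√(2 * (n + 1))) (n + 1))
  have hp := integral_mul_deriv_eq_deriv_mul_of_integrable (fun x _ => hd x)
    (fun x _ => hermiteFun_hasDerivAt n x) (hu.integrable_mul hv)
    (hu'.integrable_mul (isPolyGauss_hermiteFun n))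
    (hu.integrable_mul (isPolyGauss_hermiteFun n))
  have h1 := hu.integrable_mul (isPolyGauss_id_mul_hermiteFun n)
  have h2 := hu'.integrable_mul (isPolyGauss_hermiteFun n)
  have h3 := hu.integrable_mul (isPolyGauss_const_mul_hermiteFun (√(2 * (n + 1))) (n + 1))
  have e1 : ∫ t, (t * u t + u' t) * hermiteFun n t =
      (∫ t, u t * (t * hermiteFun n t)) + ∫ t, u' t * hermiteFun n t := by
    rw [← integral_add h1 h2]
    congr with t
    ring
  have e2 : ∫ t, u t * (t * hermiteFun n t - √(2 * (n + 1)) * hermiteFun (n + 1) t) =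
      (∫ t, u t * (t * hermiteFun n t)) -
        √(2 * (n + 1)) * ∫ t, u t * hermiteFun (n + 1) t := by
    rw [← integral_const_mul, ← integral_sub h1 (by simpa [mul_left_comm] using h3)]
    congr with t
    ring
  rw [e2] at hp
  rw [e1]
  linarith

/-- Moving the raising operator from `h_{n+1}` to `h_{m+1}`, where it lowers, reduces both indices
by one. It ends either at the annihilated `h_0` or at a Gaussian integral. -/
theorem integral_hermiteFun_mul (m n : ℕ) :
    ∫ t, hermiteFun m t * hermiteFun n t = if m = n then 1 else 0 := by
  have zero_succ : ∀ n : ℕ, ∫ t, hermiteFun 0 t * hermiteFun (n + 1) t = 0 := by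
    intro n
    have h := integral_mul_hermiteFun_succ (isPolyGauss_hermiteFun 0)
      (u' := fun t => -t * hermiteFun 0 t)
      (by simpa using (isPolyGauss_hermiteFun 0).polynomial_mul (-Polynomial.X))
      hermiteFun_zero_hasDerivAt n
    have h0 : (√(2 * ((n : ℝ) + 1))) ≠ 0 := by positivity
    have e : ∀ t, (t * hermiteFun 0 t + -t * hermiteFun 0 t) * hermiteFun n t = 0 :=
      fun t => by ring
    simp_rw [e, integral_zero] at h
    exact (mul_eq_zero.1 h).resolve_left h0
  induction n generalizing m with
  | zero =>
    cases m with
    | zero =>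
      have h : ∀ t : ℝ, hermiteFun 0 t * hermiteFun 0 t = (√Real.pi)⁻¹ * Real.exp (-1 * t ^ 2) := by
        intro t
        simp only [hermiteFun, hermitePoly, pow_zero, Nat.factorial_zero, Nat.cast_one, one_mul,
          iteratedDeriv_zero]
        rw [← Real.exp_add, add_neg_cancel, Real.exp_zero, mul_one, mul_mul_mul_comm,
          ← Real.exp_add, ← mul_inv, Real.mul_self_sqrt (by positivity)]
        ring_nf
      simp_rw [h]
      rw [integral_const_mul, integral_gaussian, div_one, inv_mul_cancel₀ (by positivity), if_pos trivial]
    | succ m =>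
      simp_rw [mul_comm (hermiteFun (m + 1) _)]
      simpa using zero_succ m
  | succ n ih =>
    cases m with
    | zero => simpa using zero_succ n
    | succ m =>
      have hu' : IsPolyGauss
          fun t => -t * hermiteFun (m + 1) t + √(2 * (m + 1)) * hermiteFun m t := by
        have h1 := (isPolyGauss_hermiteFun (m + 1)).polynomial_mul (-Polynomial.X)
        have h2 := h1.add (isPolyGauss_const_mul_hermiteFun (√(2 * (m + 1))) m)
        simpa only [Polynomial.eval_neg, Polynomial.eval_X] using h2
      have h := integral_mul_hermiteFun_succ (isPolyGauss_hermiteFun (m + 1))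
        (u' := fun t => -t * hermiteFun (m + 1) t + √(2 * (m + 1)) * hermiteFun m t)
        hu' (hermiteFun_succ_hasDerivAt m) n
      have e : ∀ t, (t * hermiteFun (m + 1) t +
          (-t * hermiteFun (m + 1) t + √(2 * (m + 1)) * hermiteFun m t)) * hermiteFun n t =
          √(2 * (m + 1)) * (hermiteFun m t * hermiteFun n t) := fun t => by ring
      simp_rw [e] at h
      rw [integral_const_mul, ih m] at h
      have h0 : (√(2 * ((n : ℝ) + 1))) ≠ 0 := by positivity
      by_cases hmn : m = n
      · subst hmn
        rw [if_pos rfl] at h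
        rw [if_pos rfl]
        exact mul_left_cancel₀ h0 h
      · rw [if_neg hmn, mul_zero] at h
        rw [if_neg (by omega)]
        exact (mul_eq_zero.1 h).resolve_left h0

/-! ### The reproducing kernel on the diagonal -/

/-- Averaging the raising and lowering formulas gives `(h_n²)' = √(2n) h_{n-1} h_n - √(2(n+1)) h_n
h_{n+1}`, which telescopes. -/
theorem hasDerivAt_sum_hermiteFun_sq (N : ℕ) (t : ℝ) :
    HasDerivAt (fun t => ∑ n ∈ Finset.range (N + 1), hermiteFun n t ^ 2)
      (-(√(2 * (N + 1)) * (hermiteFun N t * hermiteFun (N + 1) t))) t := by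
  induction N with
  | zero =>
    simp only [zero_add, Finset.range_one, Finset.sum_singleton]
    refine HasDerivAt.congr_deriv ((hermiteFun_zero_hasDerivAt t).fun_pow 2) ?_
    have := hermiteFun_one t
    simp only [CharP.cast_eq_zero, zero_add, mul_one]
    push_cast
    linear_combination hermiteFun 0 t * this
  | succ N ih =>
    simp_rw [Finset.sum_range_succ _ (N + 1)]
    refine HasDerivAt.congr_deriv (ih.fun_add ((hermiteFun_succ_hasDerivAt N t).fun_pow 2)) ?_
    have := hermiteFun_recurrence N t
    push_cast
    linear_combination hermiteFun (N + 1) t * this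

/-- The Christoffel–Darboux kernel of the Hermite functions is `O(√N)` on the diagonal. -/
theorem sum_hermiteFun_sq_le (N : ℕ) (t : ℝ) :
    ∑ n ∈ Finset.range (N + 1), hermiteFun n t ^ 2 ≤ √(2 * (N + 1)) := by
  set c := √(2 * ((N : ℝ) + 1)) with hc
  have hc0 : 0 ≤ c := Real.sqrt_nonneg _
  have hint : Integrable fun t => ∑ n ∈ Finset.range (N + 1), hermiteFun n t ^ 2 := by
    refine integrable_finsetSum _ fun n _ => ?_
    simpa only [sq] using integrable_hermiteFun_mul n n
  have hint' : Integrable fun t => -(c * (hermiteFun N t * hermiteFun (N + 1) t)) :=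
    ((integrable_hermiteFun_mul N (N + 1)).const_mul c).neg
  -- The sum and its derivative are both integrable, so the sum vanishes at infinity and equals
  -- minus the integral of its derivative over `(t, ∞)`.
  have hlim := tendsto_zero_of_hasDerivAt_of_integrableOn_Ioi (a := t)
    (fun x _ => hasDerivAt_sum_hermiteFun_sq N x) hint'.integrableOn hint.integrableOn
  have hF := integral_Ioi_of_hasDerivAt_of_tendsto' (a := t)
    (fun x _ => hasDerivAt_sum_hermiteFun_sq N x) hint'.integrableOn hlim
  have hsq : Integrable fun t => c * ((hermiteFun N t * hermiteFun N t +
      hermiteFun (N + 1) t * hermiteFun (N + 1) t) / 2) :=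
    (((integrable_hermiteFun_mul N N).add
      (integrable_hermiteFun_mul (N + 1) (N + 1))).div_const 2).const_mul c
  have hb : -∫ x in Ioi t, -(c * (hermiteFun N x * hermiteFun (N + 1) x)) ≤ c := by
    rw [← integral_neg]
    simp only [neg_neg]
    calc ∫ x in Ioi t, c * (hermiteFun N x * hermiteFun (N + 1) x)
        ≤ ∫ x in Ioi t, c * ((hermiteFun N x * hermiteFun N x +
            hermiteFun (N + 1) x * hermiteFun (N + 1) x) / 2) := by
          refine integral_mono (by simpa using hint'.neg.restrict (s := Ioi t)) hsq.integrableOn fun x => ?_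
          refine mul_le_mul_of_nonneg_left ?_ hc0
          -- By `ab ≤ (a² + b²)/2`, the integral is bounded by that of two squares, each of total
          -- mass one.
          nlinarith [sq_nonneg (hermiteFun N x - hermiteFun (N + 1) x)]
      _ ≤ ∫ x, c * ((hermiteFun N x * hermiteFun N x +
            hermiteFun (N + 1) x * hermiteFun (N + 1) x) / 2) := by
          refine setIntegral_le_integral hsq (Filter.Eventually.of_forall fun x => ?_)
          have h1 := mul_self_nonneg (hermiteFun N x)
          have h2 := mul_self_nonneg (hermiteFun (N + 1) x)
          exact mul_nonneg hc0 (by linarith)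
      _ = c := by
          rw [integral_const_mul, integral_div, integral_add (integrable_hermiteFun_mul N N)
            (integrable_hermiteFun_mul (N + 1) (N + 1)), integral_hermiteFun_mul,
            integral_hermiteFun_mul, if_pos rfl, if_pos rfl]
          norm_num
  linarith

end HermiteSpaces
namespace HermiteSpaces

/-! ### Hermite functions and monomials times a Gaussian span the same spaces -/

/-- The degree bound, absent from `hermitePoly_eq`, lets the change of basis to monomials preserve
the order. -/
theorem exists_hermitePoly_natDegree_le (n : ℕ) :
    ∃ p : Polynomial ℝ, p.natDegree ≤ n ∧ ∀ t, hermitePoly n t = p.eval t := by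
  have zero : ∀ t, hermitePoly 0 t = 1 := fun t => by
    simp [hermitePoly, ← Real.exp_add]
  induction n using Nat.twoStepInduction with
  | zero => exact ⟨1, by simp, by simpa using zero⟩
  | one => exact ⟨2 * Polynomial.X, by compute_degree, fun t => by simp [hermitePoly_one, zero]⟩
  | more n ih₁ ih₂ =>
    obtain ⟨p, hpd, hp⟩ := ih₁
    obtain ⟨q, hqd, hq⟩ := ih₂
    refine ⟨Polynomial.C 2 * Polynomial.X * q - Polynomial.C (2 * ((n : ℝ) + 1)) * p, ?_,
      fun t => ?_⟩
    · refine (Polynomial.natDegree_sub_le _ _).trans (max_le ?_ ?_)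
      · refine Polynomial.natDegree_mul_le.trans ?_
        have : (Polynomial.C (2 : ℝ) * Polynomial.X).natDegree ≤ 1 := by compute_degree
        omega
      · exact (Polynomial.natDegree_C_mul_le _ _).trans (by omega)
    · rw [hermitePoly_recurrence, hp, hq]
      simp

/-- The span of the Hermite functions of order at most `N`. -/
def hermiteSpan (N : ℕ) : Submodule ℝ (ℝ → ℝ) :=
  Submodule.span ℝ (hermiteFun '' ↑(Finset.range (N + 1)))

theorem hermiteFun_mem_hermiteSpan {n N : ℕ} (h : n ≤ N) : hermiteFun n ∈ hermiteSpan N :=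
  Submodule.subset_span ⟨n, by simpa using Nat.lt_succ_of_le h, rfl⟩

theorem hermiteSpan_mono {M N : ℕ} (h : M ≤ N) : hermiteSpan M ≤ hermiteSpan N := by
  refine Submodule.span_le.2 ?_
  rintro _ ⟨n, hn, rfl⟩
  exact hermiteFun_mem_hermiteSpan ((Nat.lt_succ_iff.1 (by simpa using hn)).trans h)

/-- The three-term recurrence solved for `t h_n` involves only the neighbours `h_{n-1}` and
`h_{n+1}`. -/
theorem id_mul_mem_hermiteSpan {N : ℕ} {f : ℝ → ℝ} (hf : f ∈ hermiteSpan N) :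
    (fun t => t * f t) ∈ hermiteSpan (N + 1) := by
  induction hf using Submodule.span_induction with
  | mem f h =>
    obtain ⟨n, hn, rfl⟩ := h
    have hn' : n ≤ N := Nat.lt_succ_iff.1 (by simpa using hn)
    cases n with
    | zero =>
      have : (fun t => t * hermiteFun 0 t) = (√2 / 2) • hermiteFun 1 := by
        ext t
        have := hermiteFun_one t
        simp only [Pi.smul_apply, smul_eq_mul]
        linarith
      rw [this]
      exact Submodule.smul_mem _ _ (hermiteFun_mem_hermiteSpan (by omega))
    | succ n =>
      have : (fun t => t * hermiteFun (n + 1) t) =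
          (√(2 * (n + 1 + 1)) / 2) • hermiteFun (n + 2) +
            (√(2 * (n + 1)) / 2) • hermiteFun n := by
        ext t
        have := hermiteFun_recurrence n t
        simp only [Pi.add_apply, Pi.smul_apply, smul_eq_mul]
        linarith
      rw [this]
      exact Submodule.add_mem _
        (Submodule.smul_mem _ _ (hermiteFun_mem_hermiteSpan (by omega)))
        (Submodule.smul_mem _ _ (hermiteFun_mem_hermiteSpan (by omega)))
  | zero =>
    convert (hermiteSpan (N + 1)).zero_mem using 1
    ext t
    simp
  | add f g _ _ hf hg =>
    convert Submodule.add_mem _ hf hg using 1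
    ext t
    simp [mul_add]
  | smul c f _ hf =>
    convert Submodule.smul_mem _ c hf using 1
    ext t
    simp [mul_left_comm]

theorem pow_mul_gauss_mem_hermiteSpan (k : ℕ) :
    (fun t : ℝ => t ^ k * Real.exp (-t ^ 2 / 2)) ∈ hermiteSpan k := by
  induction k with
  | zero =>
    have : (fun t : ℝ => t ^ 0 * Real.exp (-t ^ 2 / 2)) = √√Real.pi • hermiteFun 0 := by
      ext t
      have h : √√Real.pi ≠ 0 := by positivity
      have h0 : hermitePoly 0 t = 1 := by simp [hermitePoly, ← Real.exp_add]
      simp [hermiteFun, h0, h]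
    rw [this]
    exact Submodule.smul_mem _ _ (hermiteFun_mem_hermiteSpan le_rfl)
  | succ k ih =>
    convert id_mul_mem_hermiteSpan ih using 2 with t
    ring

/-- Monomials times the Gaussian `e^{-s t² / 2}`. -/
noncomputable def gaussMonomial (s : ℝ) (k : ℕ) (t : ℝ) : ℂ :=
  ((t ^ k * Real.exp (-(s * t ^ 2) / 2) : ℝ) : ℂ)

theorem exists_hermiteFun_eq_sum {n N : ℕ} (h : n ≤ N) : ∃ c : ℕ → ℂ, ∀ t,
    (hermiteFun n t : ℂ) = ∑ k ∈ Finset.range (N + 1), c k * gaussMonomial 1 k t := by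
  obtain ⟨p, hpd, hp⟩ := exists_hermitePoly_natDegree_le n
  refine ⟨fun k =>
    (((√(2 ^ n * (n.factorial : ℝ) * √Real.pi))⁻¹ * p.coeff k : ℝ) : ℂ), fun t => ?_⟩
  rw [hermiteFun, hp, Polynomial.eval_eq_sum_range' (n := N + 1) (by omega)]
  simp only [gaussMonomial, ← Complex.ofReal_mul, ← Complex.ofReal_sum]
  rw [Finset.mul_sum, Finset.sum_mul]
  refine congrArg _ (Finset.sum_congr rfl fun k _ => ?_)
  rw [one_mul]
  ring

theorem exists_gaussMonomial_eq_sum {k N : ℕ} (h : k ≤ N) : ∃ c : ℕ → ℂ, ∀ t,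
    gaussMonomial 1 k t = ∑ n ∈ Finset.range (N + 1), c n * (hermiteFun n t : ℂ) := by
  have hk := hermiteSpan_mono h (pow_mul_gauss_mem_hermiteSpan k)
  obtain ⟨c, hc⟩ := (Submodule.mem_span_image_finset_iff_exists_fun' ℝ).1 hk
  refine ⟨fun n => (c n : ℂ), fun t => ?_⟩
  have := congrFun hc t
  simp only [Finset.sum_apply, Pi.smul_apply, smul_eq_mul] at this
  rw [gaussMonomial, one_mul, ← this]
  push_cast
  rfl

/-! ### Spans of tensor products -/

/-- The span of the functions `B_{γ₁}(x₁) ⋯ B_{γ_d}(x_d)` with all `γ_i ≤ N`. -/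
def tensorSpan (d : ℕ) (B : ℕ → ℝ → ℂ) (N : ℕ) : Submodule ℂ (EuclideanSpace ℝ (Fin d) → ℂ) :=
  Submodule.span ℂ ((fun (γ : Fin d → ℕ) x => ∏ i, B (γ i) (x i)) ''
    ↑(Fintype.piFinset fun _ : Fin d => Finset.range (N + 1)))

variable {d : ℕ}

theorem prod_mem_tensorSpan (B : ℕ → ℝ → ℂ) {N : ℕ} {γ : Fin d → ℕ} (h : ∀ i, γ i ≤ N) :
    (fun x : EuclideanSpace ℝ (Fin d) => ∏ i, B (γ i) (x i)) ∈ tensorSpan d B N :=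
  Submodule.subset_span ⟨γ, by simpa [Nat.lt_succ_iff] using h, rfl⟩

theorem tensorSpan_induction {B : ℕ → ℝ → ℂ} {N : ℕ}
    {P : (EuclideanSpace ℝ (Fin d) → ℂ) → Prop}
    (mem : ∀ γ : Fin d → ℕ, (∀ i, γ i ≤ N) → P fun x => ∏ i, B (γ i) (x i)) (zero : P 0)
    (add : ∀ f g, P f → P g → P (f + g)) (smul : ∀ (c : ℂ) f, P f → P (c • f))
    {f : EuclideanSpace ℝ (Fin d) → ℂ} (hf : f ∈ tensorSpan d B N) : P f := by
  induction hf using Submodule.span_induction with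
  | mem f h =>
    obtain ⟨γ, hγ, rfl⟩ := h
    exact mem γ (by simpa [Nat.lt_succ_iff] using hγ)
  | zero => exact zero
  | add f g _ _ hf hg => exact add f g hf hg
  | smul c f _ hf => exact smul c f hf

/-- A product of one-variable sums expands into a sum over the full box of multi-indices; hence the
span is cut off by `γ_i ≤ N` and not by `|γ| ≤ N`. -/
theorem tensorSpan_le {A B : ℕ → ℝ → ℂ} {N : ℕ}
    (h : ∀ k ≤ N, ∃ c : ℕ → ℂ, ∀ t, A k t = ∑ j ∈ Finset.range (N + 1), c j * B j t) :
    tensorSpan d A N ≤ tensorSpan d B N := by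
  intro f hf
  refine tensorSpan_induction (P := fun f => f ∈ tensorSpan d B N) (fun γ hγ => ?_)
    (Submodule.zero_mem _) (fun _ _ => Submodule.add_mem _) (fun c _ => Submodule.smul_mem _ c) hf
  choose c hc using fun i => h (γ i) (hγ i)
  have : (fun x : EuclideanSpace ℝ (Fin d) => ∏ i, A (γ i) (x i)) =
      ∑ δ ∈ Fintype.piFinset fun _ : Fin d => Finset.range (N + 1),
        (∏ i, c i (δ i)) • fun x : EuclideanSpace ℝ (Fin d) => ∏ i, B (δ i) (x i) := by
    ext x
    simp only [hc, Finset.prod_univ_sum, Finset.sum_apply, Pi.smul_apply, smul_eq_mul,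
      Finset.prod_mul_distrib]
  rw [this]
  refine Submodule.sum_mem _ fun δ hδ => Submodule.smul_mem _ _ (prod_mem_tensorSpan B ?_)
  simpa [Nat.lt_succ_iff] using hδ

theorem tensorSpan_hermiteFun_eq (N : ℕ) :
    tensorSpan d (fun n t => (hermiteFun n t : ℂ)) N = tensorSpan d (gaussMonomial 1) N :=
  le_antisymm (tensorSpan_le fun _ h => exists_hermiteFun_eq_sum h)
    (tensorSpan_le fun _ h => exists_gaussMonomial_eq_sum h)

/-! ### Products, powers and dilations of Gaussian tensors -/

theorem gaussMonomial_mul (s s' : ℝ) (k k' : ℕ) (t : ℝ) :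
    gaussMonomial s k t * gaussMonomial s' k' t = gaussMonomial (s + s') (k + k') t := by
  rw [gaussMonomial, gaussMonomial, gaussMonomial, ← Complex.ofReal_mul, mul_mul_mul_comm,
    ← Real.exp_add, pow_add]
  ring_nf

theorem mul_mem_tensorSpan_gaussMonomial {s s' : ℝ} {N N' : ℕ}
    {f g : EuclideanSpace ℝ (Fin d) → ℂ} (hf : f ∈ tensorSpan d (gaussMonomial s) N)
    (hg : g ∈ tensorSpan d (gaussMonomial s') N') :
    f * g ∈ tensorSpan d (gaussMonomial (s + s')) (N + N') := by
  refine tensorSpan_induction (P := fun f => f * g ∈ tensorSpan d _ (N + N')) (fun γ hγ => ?_)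
    (by simp) (fun f₁ f₂ h₁ h₂ => ?_) (fun c f h => ?_) hf
  · refine tensorSpan_induction (P := fun g => _ * g ∈ tensorSpan d _ (N + N')) (fun δ hδ => ?_)
      (by simp) (fun g₁ g₂ h₁ h₂ => ?_) (fun c g h => ?_) hg
    · have : (fun x : EuclideanSpace ℝ (Fin d) => ∏ i, gaussMonomial s (γ i) (x i)) *
          (fun x => ∏ i, gaussMonomial s' (δ i) (x i)) =
          fun x => ∏ i, gaussMonomial (s + s') ((γ + δ) i) (x i) := by
        ext x
        simp only [Pi.mul_apply, ← Finset.prod_mul_distrib, gaussMonomial_mul, Pi.add_apply]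
      rw [this]
      exact prod_mem_tensorSpan _ fun i => add_le_add (hγ i) (hδ i)
    · rw [mul_add]
      exact Submodule.add_mem _ h₁ h₂
    · rw [mul_smul_comm]
      exact Submodule.smul_mem _ c h
  · rw [add_mul]
    exact Submodule.add_mem _ h₁ h₂
  · rw [smul_mul_assoc]
    exact Submodule.smul_mem _ c h

theorem pow_mem_tensorSpan_gaussMonomial {N : ℕ} {f : EuclideanSpace ℝ (Fin d) → ℂ}
    (hf : f ∈ tensorSpan d (gaussMonomial 1) N) (m : ℕ) :
    f ^ m ∈ tensorSpan d (gaussMonomial m) (m * N) := by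
  induction m with
  | zero =>
    convert prod_mem_tensorSpan (gaussMonomial (0 : ℕ)) (γ := fun _ : Fin d => 0) (N := 0 * N)
      (by simp) using 1
    ext x
    simp [gaussMonomial]
  | succ m ih =>
    rw [pow_succ, add_mul, one_mul, Nat.cast_add, Nat.cast_one]
    exact mul_mem_tensorSpan_gaussMonomial ih hf

theorem comp_smul_mem_tensorSpan_gaussMonomial {N : ℕ} {s : ℝ} (r : ℝ)
    {f : EuclideanSpace ℝ (Fin d) → ℂ} (hf : f ∈ tensorSpan d (gaussMonomial s) N) :
    (fun x => f (r • x)) ∈ tensorSpan d (gaussMonomial (s * r ^ 2)) N := by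
  refine tensorSpan_induction (P := fun f => (fun x => f (r • x)) ∈ tensorSpan d _ N)
    (fun γ hγ => ?_) (Submodule.zero_mem _) (fun f₁ f₂ h₁ h₂ => Submodule.add_mem _ h₁ h₂)
    (fun c f h => Submodule.smul_mem _ c h) hf
  have : (fun x : EuclideanSpace ℝ (Fin d) => ∏ i, gaussMonomial s (γ i) ((r • x) i)) =
      (∏ i, (r : ℂ) ^ (γ i)) • fun x => ∏ i, gaussMonomial (s * r ^ 2) (γ i) (x i) := by
    ext x
    simp only [Pi.smul_apply, smul_eq_mul, ← Finset.prod_mul_distrib]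
    refine Finset.prod_congr rfl fun i _ => ?_
    rw [gaussMonomial, gaussMonomial, ← Complex.ofReal_pow, ← Complex.ofReal_mul]
    simp only [PiLp.smul_apply, smul_eq_mul]
    ring_nf
  rw [this]
  exact Submodule.smul_mem _ _ (prod_mem_tensorSpan _ hγ)

/-- The `m`-th power carries `e^{-m|x|²/2}`, and the dilation by `1/√m` restores `e^{-|x|²/2}`. The
passage through monomials is needed because the Hermite basis itself is not stable under dilation.
-/
theorem pow_comp_smul_mem_tensorSpan {N m : ℕ} (hm : 0 < m) {f : EuclideanSpace ℝ (Fin d) → ℂ}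
    (hf : f ∈ tensorSpan d (fun n t => (hermiteFun n t : ℂ)) N) :
    (fun x => f ((√m)⁻¹ • x) ^ m) ∈ tensorSpan d (fun n t => (hermiteFun n t : ℂ)) (m * N) := by
  rw [tensorSpan_hermiteFun_eq] at hf ⊢
  have h := comp_smul_mem_tensorSpan_gaussMonomial (√m)⁻¹ (pow_mem_tensorSpan_gaussMonomial hf m)
  rwa [inv_pow, Real.sq_sqrt (by positivity), mul_inv_cancel₀ (by positivity)] at h

/-! ### Orthonormality in several variables -/

theorem continuous_hermiteFunction (β : Fin d → ℕ) :
    Continuous (hermiteFunction β : EuclideanSpace ℝ (Fin d) → ℝ) := by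
  have h : Continuous fun x => (hermiteSchwartz β x).re :=
    Complex.continuous_re.comp (hermiteSchwartz β).continuous
  simpa [hermiteSchwartz_apply] using h

theorem integrable_hermiteFunction_mul (β γ : Fin d → ℕ) :
    Integrable fun x : EuclideanSpace ℝ (Fin d) => hermiteFunction β x * hermiteFunction γ x := by
  have h : Integrable fun x : Fin d → ℝ => ∏ i, (hermiteFun (β i) (x i) * hermiteFun (γ i) (x i)) :=
    Integrable.fintype_prod (f := fun i t => hermiteFun (β i) t * hermiteFun (γ i) t)
      fun i => integrable_hermiteFun_mul _ _
  have h' :=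
    (EuclideanSpace.volume_preserving_symm_measurableEquiv_toLp (Fin d)).integrable_comp_of_integrable
      h
  simp only [hermiteFunction, ← Finset.prod_mul_distrib]
  exact h'

theorem integral_hermiteFunction_mul (β γ : Fin d → ℕ) :
    ∫ x : EuclideanSpace ℝ (Fin d), hermiteFunction β x * hermiteFunction γ x =
      if β = γ then 1 else 0 := by
  have h := (EuclideanSpace.volume_preserving_symm_measurableEquiv_toLp (Fin d)).integral_comp'
    (fun x : Fin d → ℝ => ∏ i, (hermiteFun (β i) (x i) * hermiteFun (γ i) (x i)))
  rw [integral_fintype_prod_volume_eq_prod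
    (fun i t => hermiteFun (β i) t * hermiteFun (γ i) t)] at h
  simp only [hermiteFunction, ← Finset.prod_mul_distrib]
  refine h.trans ?_
  simp_rw [integral_hermiteFun_mul]
  split_ifs with hβ
  · simp [hβ]
  · obtain ⟨i, hi⟩ := Function.ne_iff.1 hβ
    exact Finset.prod_eq_zero (Finset.mem_univ i) (if_neg hi)

/-! ### Finite Hermite expansions: Parseval and sup-norm bounds -/

theorem exists_hermite_expansion {N : ℕ} {f : EuclideanSpace ℝ (Fin d) → ℂ}
    (hf : f ∈ tensorSpan d (fun n t => (hermiteFun n t : ℂ)) N) : ∃ c : (Fin d → ℕ) → ℂ, ∀ x,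
    f x = ∑ γ ∈ Fintype.piFinset fun _ : Fin d => Finset.range (N + 1),
      c γ * (hermiteFunction γ x : ℂ) := by
  obtain ⟨c, hc⟩ := (Submodule.mem_span_image_finset_iff_exists_fun' ℂ).1 hf
  refine ⟨c, fun x => ?_⟩
  rw [← hc]
  simp [hermiteFunction]

theorem continuous_of_mem_tensorSpan {N : ℕ} {f : EuclideanSpace ℝ (Fin d) → ℂ}
    (hf : f ∈ tensorSpan d (fun n t => (hermiteFun n t : ℂ)) N) : Continuous f := by
  obtain ⟨c, hc⟩ := exists_hermite_expansion hf
  rw [funext hc]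
  have := continuous_hermiteFunction (d := d)
  fun_prop

theorem norm_sq_hermite_expansion (s : Finset (Fin d → ℕ)) (c : (Fin d → ℕ) → ℂ)
    (x : EuclideanSpace ℝ (Fin d)) :
    ‖∑ γ ∈ s, c γ * (hermiteFunction γ x : ℂ)‖ ^ 2 = ∑ γ ∈ s, ∑ δ ∈ s,
      (c γ * starRingEnd ℂ (c δ)).re * (hermiteFunction γ x * hermiteFunction δ x) := by
  have h : ((‖∑ γ ∈ s, c γ * (hermiteFunction γ x : ℂ)‖ ^ 2 : ℝ) : ℂ) = ∑ γ ∈ s, ∑ δ ∈ s,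
      (c γ * starRingEnd ℂ (c δ)) * ((hermiteFunction γ x * hermiteFunction δ x : ℝ) : ℂ) := by
    rw [Complex.ofReal_pow, ← Complex.mul_conj', map_sum, Finset.sum_mul_sum]
    refine Finset.sum_congr rfl fun γ _ => Finset.sum_congr rfl fun δ _ => ?_
    rw [map_mul, Complex.conj_ofReal]
    push_cast
    ring
  have h' := congrArg Complex.re h
  rw [Complex.ofReal_re] at h'
  simp only [Complex.re_sum, Complex.re_mul_ofReal] at h'
  exact h'

theorem integrable_norm_sq_hermite_expansion (s : Finset (Fin d → ℕ)) (c : (Fin d → ℕ) → ℂ) :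
    Integrable fun x : EuclideanSpace ℝ (Fin d) =>
      ‖∑ γ ∈ s, c γ * (hermiteFunction γ x : ℂ)‖ ^ 2 := by
  simp_rw [norm_sq_hermite_expansion]
  exact integrable_finsetSum _ fun γ _ => integrable_finsetSum _ fun δ _ =>
    (integrable_hermiteFunction_mul γ δ).const_mul _

theorem integral_norm_sq_hermite_expansion (s : Finset (Fin d → ℕ)) (c : (Fin d → ℕ) → ℂ) :
    ∫ x : EuclideanSpace ℝ (Fin d), ‖∑ γ ∈ s, c γ * (hermiteFunction γ x : ℂ)‖ ^ 2 =
      ∑ γ ∈ s, ‖c γ‖ ^ 2 := by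
  simp_rw [norm_sq_hermite_expansion]
  rw [integral_finsetSum _ fun γ _ => integrable_finsetSum _ fun δ _ =>
    (integrable_hermiteFunction_mul γ δ).const_mul _]
  refine Finset.sum_congr rfl fun γ hγ => ?_
  rw [integral_finsetSum _ fun δ _ => (integrable_hermiteFunction_mul γ δ).const_mul _]
  simp_rw [integral_const_mul, integral_hermiteFunction_mul, mul_ite, mul_one, mul_zero]
  rw [Finset.sum_ite_eq, if_pos hγ, Complex.mul_conj', ← Complex.ofReal_pow, Complex.ofReal_re]

/-- Over a box of multi-indices the diagonal kernel factors into one-dimensional ones. -/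
theorem sum_hermiteFunction_sq_le (N : ℕ) (x : EuclideanSpace ℝ (Fin d)) :
    ∑ γ ∈ Fintype.piFinset fun _ : Fin d => Finset.range (N + 1), hermiteFunction γ x ^ 2 ≤
      √(2 * (N + 1)) ^ d := by
  simp_rw [hermiteFunction, ← Finset.prod_pow]
  rw [← Finset.prod_univ_sum (fun _ : Fin d => Finset.range (N + 1))
    (fun i n => hermiteFun n (x i) ^ 2)]
  refine (Finset.prod_le_prod (fun i _ => Finset.sum_nonneg fun n _ => sq_nonneg _)
    fun i _ => sum_hermiteFun_sq_le N (x i)).trans (le_of_eq ?_)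
  simp

/-- The `L^∞`–`L²` Nikolskii inequality for Hermite expansions. -/
theorem enorm_sq_le_lintegral {N : ℕ} {f : EuclideanSpace ℝ (Fin d) → ℂ}
    (hf : f ∈ tensorSpan d (fun n t => (hermiteFun n t : ℂ)) N) (x : EuclideanSpace ℝ (Fin d)) :
    ‖f x‖ₑ ^ 2 ≤ ENNReal.ofReal (√(2 * (N + 1)) ^ d) * ∫⁻ y, ‖f y‖ₑ ^ 2 := by
  obtain ⟨c, hc⟩ := exists_hermite_expansion hf
  set s := Fintype.piFinset fun _ : Fin d => Finset.range (N + 1)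
  have e : ∀ y, ‖f y‖ₑ ^ 2 = ENNReal.ofReal (‖f y‖ ^ 2) := fun y => by
    rw [ENNReal.ofReal_pow (norm_nonneg _), ofReal_norm]
  have hint : Integrable fun y => ‖f y‖ ^ 2 := by
    simp_rw [hc]
    exact integrable_norm_sq_hermite_expansion s c
  simp_rw [e]
  rw [← ofReal_integral_eq_lintegral_ofReal hint (Filter.Eventually.of_forall fun _ => by positivity),
    ← ENNReal.ofReal_mul (by positivity)]
  refine ENNReal.ofReal_le_ofReal ?_
  simp_rw [hc]
  rw [integral_norm_sq_hermite_expansion]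
  -- Cauchy–Schwarz separates the coefficients, whose square sum is the integral by Parseval, from
  -- the diagonal kernel.
  calc ‖∑ γ ∈ s, c γ * (hermiteFunction γ x : ℂ)‖ ^ 2
      ≤ (∑ γ ∈ s, ‖c γ‖ * |hermiteFunction γ x|) ^ 2 := by
        gcongr
        refine (norm_sum_le _ _).trans (le_of_eq ?_)
        simp
    _ ≤ (∑ γ ∈ s, ‖c γ‖ ^ 2) * ∑ γ ∈ s, |hermiteFunction γ x| ^ 2 :=
        Finset.sum_mul_sq_le_sq_mul_sq _ _ _
    _ ≤ (∑ γ ∈ s, ‖c γ‖ ^ 2) * √(2 * (N + 1)) ^ d := by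
        gcongr
        simp_rw [sq_abs]
        exact sum_hermiteFunction_sq_le N x
    _ = _ := mul_comm _ _

/-- Finiteness of the supremum is what later allows its powers to be cancelled. -/
theorem iSup_enorm_lt_top {N : ℕ} {f : EuclideanSpace ℝ (Fin d) → ℂ}
    (hf : f ∈ tensorSpan d (fun n t => (hermiteFun n t : ℂ)) N) : ⨆ x, ‖f x‖ₑ < ⊤ := by
  obtain ⟨c, hc⟩ := exists_hermite_expansion hf
  have hfin : ∫⁻ y, ‖f y‖ₑ ^ 2 ≠ ⊤ := by
    have hint : Integrable fun y => ‖f y‖ ^ 2 := by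
      simp_rw [hc]
      exact integrable_norm_sq_hermite_expansion _ c
    have h := hint.2.ne
    simpa [enorm_pow] using h
  set K := ENNReal.ofReal (√(2 * (N + 1)) ^ d) * ∫⁻ y, ‖f y‖ₑ ^ 2
  have hK : K ≠ ⊤ := ENNReal.mul_ne_top ENNReal.ofReal_ne_top hfin
  refine lt_of_le_of_lt (iSup_le fun x => ?_)
    (ENNReal.rpow_lt_top_of_nonneg (y := 2⁻¹) (by norm_num) hK)
  rw [ENNReal.le_rpow_inv_iff two_pos, ENNReal.rpow_two]
  exact enorm_sq_le_lintegral hf x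

theorem lintegral_comp_inv_sqrt_smul {m : ℕ} (hm : 0 < m)
    {g : EuclideanSpace ℝ (Fin d) → ℝ≥0∞} (hg : Measurable g) :
    ∫⁻ x, g ((√m)⁻¹ • x) = ENNReal.ofReal (√m ^ d) * ∫⁻ x, g x := by
  have hr : (√m)⁻¹ ≠ 0 := by positivity
  rw [← lintegral_map hg (measurable_const_smul _), Measure.map_addHaar_smul _ hr,
    lintegral_smul_measure, finrank_euclideanSpace_fin, inv_pow, inv_inv,
    abs_of_nonneg (by positivity), smul_eq_mul]

/-- The `L^∞`–`L^{2m}` Nikolskii inequality for Hermite expansions: the `m`-th power of such an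
expansion is, after a dilation, another one. -/
theorem enorm_pow_le_lintegral {N m : ℕ} (hm : 0 < m) {f : EuclideanSpace ℝ (Fin d) → ℂ}
    (hf : f ∈ tensorSpan d (fun n t => (hermiteFun n t : ℂ)) N) (x : EuclideanSpace ℝ (Fin d)) :
    ‖f x‖ₑ ^ (2 * m) ≤ ENNReal.ofReal (√(2 * (m * N + 1)) ^ d) *
      (ENNReal.ofReal (√m ^ d) * ∫⁻ y, ‖f y‖ₑ ^ (2 * m)) := by
  -- Evaluation at `√m • x` undoes the dilation; the change of variables in the integral costs `√m ^
  -- d`.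
  have h := enorm_sq_le_lintegral (pow_comp_smul_mem_tensorSpan hm hf) (√m • x)
  rw [inv_smul_smul₀ (by positivity)] at h
  have hmeas : Measurable fun y => ‖f y‖ₑ ^ (2 * m) :=
    (continuous_of_mem_tensorSpan hf).measurable.enorm.pow_const _
  simp_rw [enorm_pow, ← pow_mul, mul_comm m 2] at h
  rw [lintegral_comp_inv_sqrt_smul hm hmeas] at h
  exact_mod_cast h

end HermiteSpaces
namespace HermiteSpaces

variable {d : ℕ}

/-! ### Nikolskii inequalities -/

theorem ofReal_two_pow (n : ℕ) : ENNReal.ofReal ((2 : ℝ) ^ n) = (2 : ℝ≥0∞) ^ (n : ℝ) := by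
  rw [ENNReal.ofReal_pow (by norm_num), ENNReal.rpow_natCast, ENNReal.ofReal_ofNat]

/-- The `L^∞`–`L^p` Nikolskii inequality for Hermite expansions of order at most `4^j`. -/
theorem exists_iSup_rpow_le_lintegral (d : ℕ) {p : ℝ} (hp : 0 < p) :
    ∃ C : ℝ≥0∞, C < ⊤ ∧ ∀ (j : ℕ) (f : EuclideanSpace ℝ (Fin d) → ℂ),
      f ∈ tensorSpan d (fun n t => (hermiteFun n t : ℂ)) (4 ^ j) →
        (⨆ x, ‖f x‖ₑ) ^ p ≤ C * 2 ^ ((j : ℝ) * d) * ∫⁻ y, ‖f y‖ₑ ^ p := by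
  -- Any `m > p` makes `2m - p` positive.
  obtain ⟨m, hm⟩ := exists_nat_gt p
  have hm0 : 0 < m := by exact_mod_cast hp.trans hm
  have hm1 : (1 : ℝ) ≤ m := by exact_mod_cast hm0
  refine ⟨ENNReal.ofReal (√(4 * m) ^ d * √m ^ d), ENNReal.ofReal_lt_top, fun j f hf => ?_⟩
  set S := ⨆ x, ‖f x‖ₑ with hS
  have hStop : S ≠ ⊤ := (iSup_enorm_lt_top hf).ne
  by_cases hS0 : S = 0
  · rw [hS0, ENNReal.zero_rpow_of_pos hp]
    exact zero_le
  -- Since `m 4^j ≥ 1`, the radicand is at most `4m 4^j`; its root contributes `2^j` per coordinate.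
  have hconst : √(2 * ((m : ℝ) * (4 ^ j : ℕ) + 1)) ^ d ≤ √(4 * m) ^ d * 2 ^ (j * d) := by
    have h4 : (1 : ℝ) ≤ 4 ^ j := one_le_pow₀ (by norm_num)
    have hs : √(4 * (m : ℝ)) * 2 ^ j = √(4 * m * 4 ^ j) := by
      rw [Real.sqrt_mul (by positivity : (0 : ℝ) ≤ 4 * m), show (4 : ℝ) ^ j = (2 ^ j) ^ 2 by
        rw [← pow_mul, mul_comm, pow_mul]; norm_num, Real.sqrt_sq (by positivity)]
    rw [pow_mul, ← mul_pow, hs]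
    refine pow_le_pow_left₀ (Real.sqrt_nonneg _) (Real.sqrt_le_sqrt ?_) _
    push_cast
    nlinarith [mul_le_mul hm1 h4 zero_le_one (by positivity)]
  set K : ℝ≥0∞ := ENNReal.ofReal (√(4 * m) ^ d * √m ^ d) * 2 ^ ((j : ℝ) * d) with hK
  have hpt : ∀ x, ‖f x‖ₑ ^ (2 * m) ≤ K * ∫⁻ y, ‖f y‖ₑ ^ (2 * m) := by
    intro x
    refine (enorm_pow_le_lintegral hm0 hf x).trans ?_
    rw [← mul_assoc]
    gcongr
    rw [← ENNReal.ofReal_mul (by positivity), hK, ← Nat.cast_mul j d, ← ofReal_two_pow,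
      ← ENNReal.ofReal_mul (by positivity)]
    refine ENNReal.ofReal_le_ofReal ?_
    calc _ ≤ √(4 * m) ^ d * 2 ^ (j * d) * √m ^ d := by gcongr
      _ = _ := by ring
  have hexp : 0 ≤ 2 * (m : ℝ) - p := by linarith
  have hint : ∫⁻ y, ‖f y‖ₑ ^ (2 * m) ≤ S ^ (2 * (m : ℝ) - p) * ∫⁻ y, ‖f y‖ₑ ^ p := by
    rw [← lintegral_const_mul _
      ((continuous_of_mem_tensorSpan hf).measurable.enorm.pow_const p)]
    refine lintegral_mono fun y => ?_
    calc ‖f y‖ₑ ^ (2 * m) = ‖f y‖ₑ ^ (2 * (m : ℝ) - p) * ‖f y‖ₑ ^ p := by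
          rw [← ENNReal.rpow_add_of_nonneg _ _ hexp hp.le, sub_add_cancel,
            ← ENNReal.rpow_natCast]
          push_cast
          rfl
      _ ≤ _ := by
          gcongr
          exact le_iSup (fun x => ‖f x‖ₑ) y
  have hsup : S ^ (2 * (m : ℝ)) ≤ S ^ (2 * (m : ℝ) - p) * (K * ∫⁻ y, ‖f y‖ₑ ^ p) := by
    rw [← ENNReal.le_rpow_inv_iff (by positivity)]
    refine iSup_le fun x => ?_
    rw [ENNReal.le_rpow_inv_iff (by positivity)]
    calc ‖f x‖ₑ ^ (2 * (m : ℝ)) = ‖f x‖ₑ ^ (2 * m) := by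
          rw [← ENNReal.rpow_natCast]
          push_cast
          rfl
      _ ≤ K * (S ^ (2 * (m : ℝ) - p) * ∫⁻ y, ‖f y‖ₑ ^ p) := (hpt x).trans (by gcongr)
      _ = _ := by ring
  have hsplit : S ^ (2 * (m : ℝ)) = S ^ (2 * (m : ℝ) - p) * S ^ p := by
    rw [← ENNReal.rpow_add_of_nonneg _ _ hexp hp.le, sub_add_cancel]
  rw [hsplit] at hsup
  -- The common factor `S^{2m-p}` is nonzero and finite, so it cancels.
  exact (ENNReal.mul_le_mul_iff_right (ENNReal.rpow_pos (pos_iff_ne_zero.2 hS0) hStop).ne'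
    (ENNReal.rpow_ne_top_of_nonneg hexp hStop)).1 hsup

/-- The `L^{p₁}`–`L^p` Nikolskii inequality for Hermite expansions of order at most `4^j`. -/
theorem exists_eLpNorm_le_eLpNorm (d : ℕ) {p p₁ : ℝ≥0∞} (hp : 0 < p) (hp₁ : p < p₁)
    (hp₁t : p₁ < ⊤) :
    ∃ C : ℝ≥0∞, C < ⊤ ∧ ∀ (j : ℕ) (f : EuclideanSpace ℝ (Fin d) → ℂ),
      f ∈ tensorSpan d (fun n t => (hermiteFun n t : ℂ)) (4 ^ j) →
        eLpNorm f p₁ volume ≤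
          C * 2 ^ ((d / p.toReal - d / p₁.toReal) * (j : ℝ)) * eLpNorm f p volume := by
  have hpt : p ≠ ⊤ := (hp₁.trans hp₁t).ne
  have hr : 0 < p.toReal := ENNReal.toReal_pos hp.ne' hpt
  have hlt : p.toReal < p₁.toReal := (ENNReal.toReal_lt_toReal hpt hp₁t.ne).2 hp₁
  obtain ⟨C, hC, h⟩ := exists_iSup_rpow_le_lintegral d hr
  have hr₁ : 0 < p₁.toReal := hr.trans hlt
  simp only [eLpNorm_eq_lintegral_rpow_enorm_toReal hp.ne' hpt,
    eLpNorm_eq_lintegral_rpow_enorm_toReal (hp.trans hp₁).ne' hp₁t.ne]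
  set r := p.toReal
  set r₁ := p₁.toReal
  have hθ : 0 ≤ 1 / r - 1 / r₁ := sub_nonneg.2 (one_div_le_one_div_of_le hr hlt.le)
  refine ⟨C ^ (1 / r - 1 / r₁), ENNReal.rpow_lt_top_of_nonneg hθ hC.ne, fun j f hf => ?_⟩
  set S := ⨆ x, ‖f x‖ₑ with hS
  set I := ∫⁻ y, ‖f y‖ₑ ^ r with hI
  have hint : ∫⁻ y, ‖f y‖ₑ ^ r₁ ≤ S ^ (r₁ - r) * I := by
    rw [hI, ← lintegral_const_mul _
      ((continuous_of_mem_tensorSpan hf).measurable.enorm.pow_const r)]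
    refine lintegral_mono fun y => ?_
    calc ‖f y‖ₑ ^ r₁ = ‖f y‖ₑ ^ (r₁ - r) * ‖f y‖ₑ ^ r := by
          rw [← ENNReal.rpow_add_of_nonneg _ _ (by linarith) hr.le, sub_add_cancel]
      _ ≤ _ := mul_le_mul_left
          (ENNReal.rpow_le_rpow (le_iSup (fun x => ‖f x‖ₑ) y) (by linarith)) _
  have hSK : S ≤ (C * 2 ^ ((j : ℝ) * d) * I) ^ (1 / r) := by
    rw [one_div, ENNReal.le_rpow_inv_iff hr]
    exact h j f hf
  calc (∫⁻ y, ‖f y‖ₑ ^ r₁) ^ (1 / r₁)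
      ≤ (((C * 2 ^ ((j : ℝ) * d) * I) ^ (1 / r)) ^ (r₁ - r) * I) ^ (1 / r₁) := by
        refine ENNReal.rpow_le_rpow (hint.trans ?_) (by positivity)
        exact mul_le_mul_left (ENNReal.rpow_le_rpow hSK (by linarith)) _
    -- The exponents multiply to `(r₁ - r)/(r r₁) = 1/r - 1/r₁`; the two powers of `I` then combine
    -- to `I^{1/r}`.
    _ = (C * 2 ^ ((j : ℝ) * d) * I) ^ (1 / r - 1 / r₁) * I ^ (1 / r₁) := by
        rw [ENNReal.mul_rpow_of_nonneg _ _ (by positivity), ← ENNReal.rpow_mul,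
          ← ENNReal.rpow_mul]
        congr 2
        field_simp
    _ = C ^ (1 / r - 1 / r₁) * 2 ^ ((d / r - d / r₁) * (j : ℝ)) * I ^ (1 / r) := by
        rw [ENNReal.mul_rpow_of_nonneg _ _ hθ, ENNReal.mul_rpow_of_nonneg _ _ hθ, mul_assoc,
          ← ENNReal.rpow_add_of_nonneg _ _ hθ (by positivity), sub_add_cancel,
          ← ENNReal.rpow_mul]
        congr 3
        ring

/-! ### Convolutions with the dyadic kernels -/

/-- Multi-indices with `|β| = ν` lie in the box `β_i ≤ ν`, and `f` enters only through the
coefficients `f(𝓗_β)`. -/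
theorem projKernel_conv_mem_tensorSpan {ν N : ℕ} (h : ν ≤ N)
    (f : 𝓢'(EuclideanSpace ℝ (Fin d), ℂ)) :
    kernelConv (projKernel ν) f ∈ tensorSpan d (fun n t => (hermiteFun n t : ℂ)) N := by
  have e : kernelConv (projKernel ν) f =
      ∑ β ∈ Finset.piAntidiag (Finset.univ : Finset (Fin d)) ν,
        f (hermiteSchwartz β) • fun x => ∏ i, (hermiteFun (β i) (x i) : ℂ) := by
    ext x
    simp [kernelConv, projKernel, hermiteFunction, mul_comm]
  rw [e]
  refine Submodule.sum_mem _ fun β hβ => Submodule.smul_mem _ _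
    (prod_mem_tensorSpan (fun n t => (hermiteFun n t : ℂ)) fun i => le_trans ?_ h)
  rw [Finset.mem_piAntidiag] at hβ
  rw [← hβ.1]
  exact Finset.single_le_sum (fun _ _ => Nat.zero_le _) (Finset.mem_univ i)

theorem dyadicKernel_conv_mem_tensorSpan {a : ℝ → ℂ} (ha : IsAdmissible a) (j : ℕ)
    (f : 𝓢'(EuclideanSpace ℝ (Fin d), ℂ)) :
    kernelConv (dyadicKernel a j) f ∈
      tensorSpan d (fun n t => (hermiteFun n t : ℂ)) (4 ^ j) := by
  cases j with
  | zero => exact projKernel_conv_mem_tensorSpan (Nat.zero_le _) f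
  | succ i =>
    -- The support condition forces `ν / 4^i ≤ 4`, that is `ν ≤ 4^{i+1}`, so the series is a finite
    -- sum.
    have hzero : ∀ ν ∉ Finset.range (4 ^ (i + 1) + 1), a ((ν : ℝ) / 4 ^ i) = 0 := by
      intro ν hν
      by_contra hne
      have h4 := (ha.support_subset _ (by positivity) hne).2
      rw [div_le_iff₀ (by positivity), ← pow_succ'] at h4
      have : ν ≤ 4 ^ (i + 1) := by exact_mod_cast h4
      exact hν (Finset.mem_range.2 (by omega))
    have e : kernelConv (dyadicKernel a (i + 1)) f =
        ∑ ν ∈ Finset.range (4 ^ (i + 1) + 1),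
          a ((ν : ℝ) / 4 ^ i) • kernelConv (projKernel ν) f := by
      ext x
      have hk : dyadicKernel a (i + 1) x = ∑ ν ∈ Finset.range (4 ^ (i + 1) + 1),
          a ((ν : ℝ) / 4 ^ i) • projKernel ν x :=
        tsum_eq_sum fun ν hν => by rw [hzero ν hν, zero_smul]
      simp [kernelConv, hk]
    rw [e]
    refine Submodule.sum_mem _ fun ν hν => Submodule.smul_mem _ _
      (projKernel_conv_mem_tensorSpan ?_ f)
    exact Nat.lt_succ_iff.1 (Finset.mem_range.1 hν)

theorem measurable_enorm_dyadicKernel_conv {a : ℝ → ℂ} (ha : IsAdmissible a) (j : ℕ)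
    (f : 𝓢'(EuclideanSpace ℝ (Fin d), ℂ)) :
    Measurable fun x => ‖kernelConv (dyadicKernel a j) f x‖ₑ :=
  (continuous_of_mem_tensorSpan (dyadicKernel_conv_mem_tensorSpan ha j f)).measurable.enorm

theorem measurable_weighted_dyadicKernel_conv {a : ℝ → ℂ} (ha : IsAdmissible a) (α : ℝ) (j : ℕ)
    (f : 𝓢'(EuclideanSpace ℝ (Fin d), ℂ)) :
    Measurable fun x => (2 : ℝ≥0∞) ^ (α * (j : ℝ)) * ‖kernelConv (dyadicKernel a j) f x‖ₑ :=
  (measurable_enorm_dyadicKernel_conv ha j f).const_mul _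

/-- Moving the weight inside the `L^p` quasi-norm makes both norms mixed norms of the same sequence
of functions, as the Minkowski inequalities require. -/
theorem besovNorm_eq {a : ℝ → ℂ} (ha : IsAdmissible a) (α : ℝ) {p : ℝ≥0∞} (hp : 0 < p)
    (hpt : p < ⊤) (q : ℝ≥0∞) (f : 𝓢'(EuclideanSpace ℝ (Fin d), ℂ)) :
    besovNorm a α p q f = lqNorm q fun j => eLpNorm (fun x => (2 : ℝ≥0∞) ^ (α * (j : ℝ)) *
      ‖kernelConv (dyadicKernel a j) f x‖ₑ) p volume := by
  unfold besovNorm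
  congr with j
  have hr : 0 < p.toReal := ENNReal.toReal_pos hp.ne' hpt.ne
  simp only [eLpNorm_eq_lintegral_rpow_enorm_toReal hp.ne' hpt.ne, enorm_eq_self,
    ENNReal.mul_rpow_of_nonneg _ _ hr.le]
  rw [lintegral_const_mul _ ((measurable_enorm_dyadicKernel_conv ha j f).pow_const _),
    ENNReal.mul_rpow_of_nonneg _ _ (by positivity), one_div, ENNReal.rpow_rpow_inv hr.ne']

/-! ### Embeddings -/

theorem besov_embeds_besov_smoothness (a : ℝ → ℂ) {p q q₁ : ℝ≥0∞} (α : ℝ) {ε : ℝ}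
    (hq : 0 < q) (hq₁ : 0 < q₁) (hε : 0 < ε) :
    ContinuouslyEmbeds (d := d) (besovNorm a (α + ε) p q) (besovNorm a α p q₁) :=
  continuouslyEmbeds_of_le (lqNorm_geometric_lt_top hq₁ hε)
    fun _ => lqNorm_weight_le hq hq₁ α ε _

/-- The Nikolskii loss `2^{j(d/p - d/p₁)}` is exactly the smoothness gap `2^{j(α - α₁)}`. -/
theorem besov_embeds_besov_integrability {a : ℝ → ℂ} (ha : IsAdmissible a) {p p₁ q : ℝ≥0∞}
    {α α₁ : ℝ} (hp : 0 < p) (hp₁ : p < p₁) (hp₁t : p₁ < ⊤) (hq : 0 < q)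
    (h : α - d / p.toReal = α₁ - d / p₁.toReal) :
    ContinuouslyEmbeds (d := d) (besovNorm a α p q) (besovNorm a α₁ p₁ q) := by
  obtain ⟨C, hC, hN⟩ := exists_eLpNorm_le_eLpNorm d hp hp₁ hp₁t
  refine continuouslyEmbeds_of_le hC fun f => ?_
  unfold besovNorm
  rw [← lqNorm_const_mul hq]
  refine lqNorm_mono fun j => ?_
  calc (2 : ℝ≥0∞) ^ (α₁ * (j : ℝ)) * eLpNorm (kernelConv (dyadicKernel a j) f) p₁ volume
      ≤ 2 ^ (α₁ * (j : ℝ)) * (C * 2 ^ ((d / p.toReal - d / p₁.toReal) * (j : ℝ)) *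
          eLpNorm (kernelConv (dyadicKernel a j) f) p volume) := by
        gcongr
        exact hN j _ (dyadicKernel_conv_mem_tensorSpan ha j f)
    _ = C * ((2 ^ (α₁ * (j : ℝ)) * 2 ^ ((d / p.toReal - d / p₁.toReal) * (j : ℝ))) *
          eLpNorm (kernelConv (dyadicKernel a j) f) p volume) := by ring
    _ = _ := by
        rw [← two_rpow_add, ← add_mul,
          show α₁ + (d / p.toReal - d / p₁.toReal) = α by linarith]

/-- Minkowski applies because `min p q ≤ p`; then `min p q ≤ q` allows the pointwise passage to
`ℓ^q`. -/
theorem besov_embeds_triebelLizorkin {a : ℝ → ℂ} (ha : IsAdmissible a) {p q : ℝ≥0∞} (α : ℝ)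
    (hp : 0 < p) (hpt : p < ⊤) (hq : 0 < q) :
    ContinuouslyEmbeds (d := d) (besovNorm a α p (min p q)) (triebelLizorkinNorm a α p q) := by
  refine continuouslyEmbeds_of_le ENNReal.one_lt_top fun f => ?_
  rw [one_mul, besovNorm_eq ha α hp hpt]
  refine le_trans ?_ (eLpNorm_lqNorm_le_of_le hpt.ne (lt_min hp hq) (min_le_left p q)
    fun j => measurable_weighted_dyadicKernel_conv ha α j f)
  refine eLpNorm_mono_enorm fun x => ?_
  simp only [enorm_eq_self]
  exact lqNorm_anti (lt_min hp hq) (min_le_right p q) _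

/-- Dually, `p ≤ max p q` gives Minkowski and `q ≤ max p q` the pointwise comparison. -/
theorem triebelLizorkin_embeds_besov {a : ℝ → ℂ} (ha : IsAdmissible a) {p q : ℝ≥0∞} (α : ℝ)
    (hp : 0 < p) (hpt : p < ⊤) (hq : 0 < q) :
    ContinuouslyEmbeds (d := d) (triebelLizorkinNorm a α p q) (besovNorm a α p (max p q)) := by
  refine continuouslyEmbeds_of_le ENNReal.one_lt_top fun f => ?_
  rw [one_mul, besovNorm_eq ha α hp hpt]
  refine (lqNorm_eLpNorm_le_of_le hpt.ne hp (le_max_left p q)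
    fun j => measurable_weighted_dyadicKernel_conv ha α j f).trans ?_
  refine eLpNorm_mono_enorm fun x => ?_
  simp only [enorm_eq_self]
  exact lqNorm_anti hq (le_max_right p q) _

end HermiteSpaces

theorem proposition5p5 (d : ℕ) (hd : 1 ≤ d) (a : ℝ → ℂ) (ha : HermiteSpaces.IsAdmissible a) :
    (∀ (p q q₁ : ℝ≥0∞) (α ε : ℝ), 0 < p → 0 < q → 0 < q₁ → 0 < ε →
      HermiteSpaces.ContinuouslyEmbeds (d := d)
        (HermiteSpaces.besovNorm a (α + ε) p q) (HermiteSpaces.besovNorm a α p q₁)) ∧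
    (∀ (p p₁ q : ℝ≥0∞) (α α₁ : ℝ), 0 < p → p < p₁ → p₁ < ⊤ → 0 < q → α₁ < α →
      α - d / p.toReal = α₁ - d / p₁.toReal →
      HermiteSpaces.ContinuouslyEmbeds (d := d)
        (HermiteSpaces.besovNorm a α p q) (HermiteSpaces.besovNorm a α₁ p₁ q)) ∧
    (∀ (p q : ℝ≥0∞) (α : ℝ), 0 < p → p < ⊤ → 0 < q →
      HermiteSpaces.ContinuouslyEmbeds (d := d)
        (HermiteSpaces.besovNorm a α p (min p q)) (HermiteSpaces.triebelLizorkinNorm a α p q) ∧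
      HermiteSpaces.ContinuouslyEmbeds (d := d)
        (HermiteSpaces.triebelLizorkinNorm a α p q) (HermiteSpaces.besovNorm a α p (max p q))) :=
  ⟨fun _ _ _ α _ _ hq hq₁ hε => HermiteSpaces.besov_embeds_besov_smoothness a α hq hq₁ hε,
    fun _ _ _ _ _ hp hp₁ hp₁t hq _ h =>
      HermiteSpaces.besov_embeds_besov_integrability ha hp hp₁ hp₁t hq h,
    fun _ _ α hp hpt hq => ⟨HermiteSpaces.besov_embeds_triebelLizorkin ha α hp hpt hq,
      HermiteSpaces.triebelLizorkin_embeds_besov ha α hp hpt hq⟩⟩
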